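/- Fix a prime $p$. Let $\mathcal K_p$ be the class of abelian groups isomorphic to the $p$-adic completion $\overline{\mathbf Z_p^{(\kappa)}}$ of a free $\mathbf Z_p$-module, $\kappa$ any cardinal, where $A\preccurlyeq B$ means that $A$ is a subgroup of $B$ which is pure ($b\in A$ divisible by $n\in\mathbf Z$ in $B$ is divisible by $n$ in $A$) and closed in the $p$-adic topology. Put $\|x\|_p=p^{-\max\{k\,:\,p^k\mid x\}}$ (and $\|0\|_p=0$), $d(x,y)=\|x-y\|_p$ and $d(x,S)=\inf_{s\in S}d(x,s)$. A $\mathcal K_p$-embedding is an injective homomorphism $f:M\to N$ with $f(M)\preccurlyeq N$. Let $\lambda$ be an uncountable cardinal and let $M=\overline{\mathbf Z_p^{(\kappa)}}$ with $\kappa\ge\lambda$ (a monster model); call a subset of $M$ small if its cardinality is less than $\lambda$. For tuples $a,b$ of elements of $M$ and $A\subseteq M$, write $t^g(a/A)=t^g(b/A)$ (equality of Galois types) if there are $N\in\mathcal K_p$ and $\mathcal K_p$-embeddings $f,g:M\to N$ with $f|_A=g|_A$ and $f(a)=g(b)$. A sequence $(s_i)_{i<\omega}$ of finite tuples of equal length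 is $A$-indiscernible if $t^g(s_{i_1}\cdots s_{i_m}/A)=t^g(s_{j_1}\cdots s_{j_m}/A)$ for all $m$, $i_1<\dots<i_m$ and $j_1<\dots<j_m$. For a finite tuple $a$, $t^g(a/D)$ splits strongly over $C$ if there is a $C$-indiscernible sequence $(s_i)_{i<\omega}$ of finite tuples with $s_0,s_1$ in $D$ and $t^g(as_0/C)\ne t^g(as_1/C)$. Let $\kappa(\mathcal K_p)$ be the least cardinal $\mu$ such that there is no strongly splitting sequence of length $\mu$, i.e. no finite tuple $a$ and increasing sequence $(A_i)_{i<\mu}$ of small sets such that $t^g(a/A_j)$ splits strongly over $A_i$ for all $i<j<\mu$. For a finite tuple $a$ and small $A,B$, write $a\downarrow_AB$ if there is $C\subseteq A$ with $|C|<\kappa(\mathcal K_p)$ such that for every small $D\supseteq A\cup B$ there is $b$ in $M$ with $t^g(b/A\cup B)=t^g(a/A\cup B)$ such that $t^g(b/D)$ does not split strongly over $C$. Finally, for $A\subseteq M$ let $\langle A\rangle_P=\{b\in M:\ nb\in\langle A\rangle\text{ for some integer }n\ge 1\}$ be the pure subgroup generated by $A$. Then for all small $A,B\subseteq M$ and every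 single element $a\in M$, $$a\downarrow_AB\iff d(a,\langle A\rangle_P)=d(a,\langle A\cup B\rangle_P).$$ -/

import Mathlib

universe u

noncomputable section

namespace PadicClass

open Cardinal

/-- The `p`-adic completion of the free `ℤ_p`-module (direct sum of copies of `ℤ_p`) on `ι`. -/
abbrev FreeCompletion (p : ℕ) [Fact p.Prime] (ι : Type u) : Type u :=
  AdicCompletion (Ideal.span {(p : ℤ_[p])}) (ι →₀ ℤ_[p])

/-- Membership in the class `K_p`: the abelian group `M` is isomorphic, as a group, to the
`p`-adic completion of a free `ℤ_p`-module. -/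
def InClass (p : ℕ) [Fact p.Prime] (M : Type u) [AddCommGroup M] : Prop :=
  ∃ ι : Type u, Nonempty (M ≃+ FreeCompletion p ι)

/-- A pure subgroup: an element of `B` that is divisible by `n` in the whole group is divisible
by `n` in `B`. -/
def IsPure {M : Type u} [AddCommGroup M] (B : AddSubgroup M) : Prop :=
  ∀ (n : ℤ), ∀ b ∈ B, (∃ x : M, n • x = b) → ∃ c ∈ B, n • c = b

/-- A subgroup that is closed in the `p`-adic topology, for which the subgroups `p ^ k M`
form a neighbourhood basis of `0`. -/
def IsPadicClosed (p : ℕ) {M : Type u} [AddCommGroup M] (B : AddSubgroup M) : Prop :=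
  ∀ x : M, (∀ k : ℕ, ∃ b ∈ B, ∃ y : M, x - b = p ^ k • y) → x ∈ B

/-- A strong embedding (`K`-embedding): an embedding of groups whose image is a strong submodel,
that is, a closed pure subgroup. -/
def IsStrongEmbedding (p : ℕ) {M N : Type u} [AddCommGroup M] [AddCommGroup N]
    (f : M →+ N) : Prop :=
  Function.Injective f ∧ IsPure f.range ∧ IsPadicClosed p f.range

/-- Equality of Galois types `t^g(a/A) = t^g(b/A)` of two tuples over a parameter set:
the model can be strongly embedded in two ways into one model of the class, so that the two
embeddings agree on `A` and identify `a` with `b`. -/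
def SameType (p : ℕ) [Fact p.Prime] {M : Type u} [AddCommGroup M] {I : Type*}
    (A : Set M) (a b : I → M) : Prop :=
  ∃ (N : Type u) (_ : AddCommGroup N), InClass p N ∧
    ∃ f g : M →+ N, IsStrongEmbedding p f ∧ IsStrongEmbedding p g ∧
      (∀ x ∈ A, f x = g x) ∧ ∀ i, f (a i) = g (b i)

/-- A sequence of `n`-tuples that is indiscernible over `A`: any two finite increasing
subsequences of equal length have the same Galois type over `A`. -/
def IsIndiscernible (p : ℕ) [Fact p.Prime] {M : Type u} [AddCommGroup M] {n : ℕ}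
    (A : Set M) (s : ℕ → Fin n → M) : Prop :=
  ∀ (m : ℕ) (i j : Fin m → ℕ), StrictMono i → StrictMono j →
    SameType p A (fun q : Fin m × Fin n => s (i q.1) q.2) (fun q => s (j q.1) q.2)

/-- `t^g(a/D)` splits strongly over `C`: there is a `C`-indiscernible sequence of finite tuples
with its first two members in `D` such that `a` followed by the first member and `a` followed
by the second member have different Galois types over `C`. -/
def SplitsStrongly (p : ℕ) [Fact p.Prime] {M : Type u} [AddCommGroup M] {n : ℕ}
    (a : Fin n → M) (D C : Set M) : Prop :=
  ∃ (m : ℕ) (s : ℕ → Fin m → M), IsIndiscernible p C s ∧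
    (∀ l, s 0 l ∈ D) ∧ (∀ l, s 1 l ∈ D) ∧
    ¬ SameType p C (Sum.elim a (s 0)) (Sum.elim a (s 1))

/-- Existence of a strongly splitting sequence of length `μ`: a finite tuple `a` and an increasing
sequence of (small) sets `A i`, `i < μ`, such that `t^g(a/A j)` splits strongly over `A i`
whenever `i < j`. Small means: of cardinality less than `lam`. -/
def HasStronglySplittingSequence (p : ℕ) [Fact p.Prime] (M : Type u) [AddCommGroup M]
    (lam μ : Cardinal.{u}) : Prop :=
  ∃ (n : ℕ) (a : Fin n → M) (A : Ordinal.{u} → Set M),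
    (∀ i < μ.ord, #(A i) < lam) ∧
    ∀ i j, i < j → j < μ.ord → A i ⊆ A j ∧ SplitsStrongly p a (A j) (A i)

/-- The least cardinal `μ` such that there is no strongly splitting sequence of length `μ`. -/
def kappa (p : ℕ) [Fact p.Prime] (M : Type u) [AddCommGroup M] (lam : Cardinal.{u}) :
    Cardinal.{u} :=
  sInf {μ | ¬ HasStronglySplittingSequence p M lam μ}

/-- Independence `a ↓_A B` inside the monster model `M`, where the parameter sets are the subsets
of `M` of cardinality less than `lam`. -/
def Indep (p : ℕ) [Fact p.Prime] {M : Type u} [AddCommGroup M] (lam : Cardinal.{u}) {n : ℕ}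
    (a : Fin n → M) (A B : Set M) : Prop :=
  ∃ C : Set M, C ⊆ A ∧ #C < kappa p M lam ∧
    ∀ D : Set M, A ∪ B ⊆ D → #D < lam →
      ∃ b : Fin n → M, SameType p (A ∪ B) b a ∧ ¬ SplitsStrongly p b D C

/-- The pure subgroup generated by `A` (in a torsion-free group): all `b` with `n b` in the
subgroup generated by `A` for some positive integer `n`. -/
def pcl {M : Type u} [AddCommGroup M] (A : Set M) : Set M :=
  {b | ∃ n : ℕ, 0 < n ∧ n • b ∈ AddSubgroup.closure A}

/-- The `p`-adic norm `p ^ (-max {k : p ^ k ∣ x})`, which is `0` if there is no maximum. -/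
def pNorm (p : ℕ) {M : Type u} [AddCommGroup M] (x : M) : ℝ :=
  sInf {r : ℝ | ∃ k : ℕ, (∃ y : M, x = p ^ k • y) ∧ r = ((p : ℝ) ^ k)⁻¹}

/-- The distance from a point to a nonempty set, for the `p`-adic metric `d(x, y) = ‖x - y‖_p`. -/
def distTo (p : ℕ) {M : Type u} [AddCommGroup M] (x : M) (S : Set M) : ℝ :=
  sInf ((fun b => pNorm p (x - b)) '' S)

end PadicClass

end

namespace PadicClass
open Cardinal

/-! The class consists of the `p`-torsion-free groups that are Hausdorff and complete in the
`p`-adic topology (`inClass_iff_isPComplete`). Amalgamating two copies of `M` in a quotient of `M ×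
M` shows that a Galois type over `A` records exactly which powers of `p` divide each integral
combination of the tuple plus an element of `⟨A⟩` (`sameType_iff`).

Let `G` be a subgroup closed under division by `p`, and let the family `e` be independent modulo `p`
over `G`. Then `p ^ r` divides `∑ n i • e i + x`, with `x ∈ G`, only if it divides every `n i` and
`x`. Hence for `c ∈ G` an infinite such family gives a sequence `c + p ^ m • e i` indiscernible over
`G`. An element congruent to its first term modulo `p ^ (m + 1)` is not congruent to the second, so
it splits strongly (`splitsStrongly_of_indepOver`).

If the distance drops from `A` to `A ∪ B`, some `c ∈ ⟨A ∪ B⟩_P` is closer to `a` than anything in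
`⟨A⟩_P`. For each `C ⊆ A`, write `c = c₀ + p ^ m • f 0` with `c₀ ∈ ⟨C⟩_P` and `f 0` independent over
`⟨C⟩_P`. Once `D` contains `c` and `c₀ + p ^ m • f 1`, every realization of the type of `a` over `A
∪ B` splits strongly over `C` (`near_of_indep`).

If the distance does not drop and is positive, then `a = c + p ^ m • y` with `c ∈ ⟨A⟩_P` and `y`
independent over `⟨A ∪ B⟩_P`. Replacing `y` by an element independent over `⟨D⟩_P` keeps the type
and avoids splitting over a finite `C` carrying `c`. If the distance to `⟨A⟩_P` is zero, a countable
`C` approximating `a` works with `b = a`; it is admissible because `κ > ℵ₀` (`aleph0_lt_kappa`). -/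

/-- The subgroup `p ^ k X` of an abelian group `X`. -/
def powSubgroup (p k : ℕ) {X : Type*} [AddCommGroup X] : AddSubgroup X :=
  (nsmulAddMonoidHom (p ^ k)).range

/-! ### Divisibility by powers of `p`. -/

section Basic

variable {p : ℕ} {X Y : Type*} [AddCommGroup X] [AddCommGroup Y]

theorem mem_powSubgroup {k : ℕ} {x : X} : x ∈ powSubgroup p k ↔ ∃ y, p ^ k • y = x := by
  simp [powSubgroup, AddMonoidHom.mem_range]

theorem nsmul_mem_powSubgroup (k : ℕ) (x : X) : p ^ k • x ∈ powSubgroup p k :=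
  mem_powSubgroup.2 ⟨x, rfl⟩

theorem nsmul_mem_powSubgroup_add {j k : ℕ} {x : X} (hx : x ∈ powSubgroup p k) :
    p ^ j • x ∈ powSubgroup p (j + k) := by
  obtain ⟨y, rfl⟩ := mem_powSubgroup.1 hx
  exact mem_powSubgroup.2 ⟨y, by rw [pow_add, mul_smul]⟩

theorem powSubgroup_anti {j k : ℕ} (h : j ≤ k) :
    (powSubgroup p k : AddSubgroup X) ≤ powSubgroup p j := by
  intro x hx
  obtain ⟨y, rfl⟩ := mem_powSubgroup.1 hx
  obtain ⟨l, rfl⟩ := Nat.exists_eq_add_of_le h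
  exact mem_powSubgroup.2 ⟨p ^ l • y, by rw [pow_add, mul_smul]⟩

theorem mem_powSubgroup_zero (x : X) : x ∈ powSubgroup p 0 :=
  mem_powSubgroup.2 ⟨x, by simp⟩

theorem map_mem_powSubgroup (f : X →+ Y) {k : ℕ} {x : X} (hx : x ∈ powSubgroup p k) :
    f x ∈ powSubgroup p k := by
  obtain ⟨y, rfl⟩ := mem_powSubgroup.1 hx
  exact mem_powSubgroup.2 ⟨f y, by rw [map_nsmul]⟩

theorem zsmul_mem_powSubgroup_of_dvd {k : ℕ} {n : ℤ} (h : (p : ℤ) ^ k ∣ n) (x : X) :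
    n • x ∈ powSubgroup p k := by
  obtain ⟨m, rfl⟩ := h
  refine mem_powSubgroup.2 ⟨m • x, ?_⟩
  rw [mul_smul, ← natCast_zsmul]
  push_cast
  rfl

theorem mem_of_zsmul_mem {k : ℕ} {n : ℤ} (h : IsCoprime n (p : ℤ)) {x : X}
    (hx : n • x ∈ powSubgroup p k) : x ∈ powSubgroup p k := by
  obtain ⟨u, v, huv⟩ := h.pow_right (n := k)
  have : x = u • n • x + (v * (p : ℤ) ^ k) • x := by
    rw [← mul_smul, ← add_smul, huv, one_smul]
  rw [this]
  exact add_mem (zsmul_mem hx _) (zsmul_mem_powSubgroup_of_dvd (dvd_mul_left _ _) x)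

end Basic

/-- An abelian group that is `p`-torsion-free, and Hausdorff and complete in the `p`-adic
topology. -/
structure IsPComplete (p : ℕ) (X : Type*) [AddCommGroup X] : Prop where
  torsionFree : ∀ x : X, p • x = 0 → x = 0
  hausdorff : ∀ x : X, (∀ k, x ∈ powSubgroup p k) → x = 0
  complete : ∀ u : ℕ → X, (∀ k, u (k + 1) - u k ∈ powSubgroup p k) →
    ∃ x, ∀ k, x - u k ∈ powSubgroup p k

/-! ### Complete groups, strong embeddings, and independence modulo `p`. -/

section IsPComplete

variable {p : ℕ} {X Y : Type*} [AddCommGroup X] [AddCommGroup Y]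

theorem IsPComplete.of_addEquiv (h : IsPComplete p X) (e : X ≃+ Y) : IsPComplete p Y where
  torsionFree y hy := by
    have := h.torsionFree (e.symm y) (by rw [← map_nsmul, hy, map_zero])
    simpa using this
  hausdorff y hy := by
    have := h.hausdorff (e.symm y) fun k => map_mem_powSubgroup e.symm.toAddMonoidHom (hy k)
    simpa using this
  complete u hu := by
    obtain ⟨x, hx⟩ := h.complete (fun k => e.symm (u k)) fun k => by
      have := map_mem_powSubgroup e.symm.toAddMonoidHom (hu k)
      simpa using this
    refine ⟨e x, fun k => ?_⟩
    have := map_mem_powSubgroup e.toAddMonoidHom (hx k)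
    simpa using this

theorem IsPComplete.eq_zero_of_pow_nsmul (h : IsPComplete p X) (k : ℕ) {x : X}
    (hx : p ^ k • x = 0) : x = 0 := by
  induction k with
  | zero => simpa using hx
  | succ k ih => exact ih (h.torsionFree _ (by rwa [← mul_smul, mul_comm, ← pow_succ]))

theorem IsPComplete.pow_nsmul_mem_iff (h : IsPComplete p X) {j k : ℕ} {x : X} :
    p ^ j • x ∈ powSubgroup p (j + k) ↔ x ∈ powSubgroup p k := by
  refine ⟨fun hx => ?_, nsmul_mem_powSubgroup_add⟩
  obtain ⟨y, hy⟩ := mem_powSubgroup.1 hx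
  refine mem_powSubgroup.2 ⟨y, sub_eq_zero.1 (h.eq_zero_of_pow_nsmul j ?_)⟩
  rw [smul_sub, ← mul_smul, ← pow_add, hy, sub_self]

theorem exists_eq_pow_mul_isCoprime [hp : Fact p.Prime] {n : ℤ} (hn : n ≠ 0) :
    ∃ (j : ℕ) (m : ℤ), n = (p : ℤ) ^ j * m ∧ IsCoprime m (p : ℤ) := by
  have hpz : Prime (p : ℤ) := Nat.prime_iff_prime_int.1 hp.out
  have hfin : FiniteMultiplicity (p : ℤ) n :=
    FiniteMultiplicity.of_prime_left hpz hn
  obtain ⟨m, hm, hm'⟩ := hfin.exists_eq_pow_mul_and_not_dvd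
  exact ⟨_, m, hm, ((Prime.coprime_iff_not_dvd hpz).2 hm').symm⟩

/-- The shift `j` is the exponent of `p` in `n`; the factor prime to `p` does not affect
divisibility by powers of `p`. -/
theorem IsPComplete.exists_zsmul_mem_iff [Fact p.Prime] (h : IsPComplete p X) {n : ℤ}
    (hn : n ≠ 0) :
    ∃ j, ∀ (k : ℕ) (x : X), n • x ∈ powSubgroup p (j + k) ↔ x ∈ powSubgroup p k := by
  obtain ⟨j, m, rfl, hm⟩ := exists_eq_pow_mul_isCoprime (p := p) hn
  refine ⟨j, fun k x => ?_⟩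
  have : ((p : ℤ) ^ j * m) • x = p ^ j • m • x := by
    rw [mul_smul, ← natCast_zsmul]; push_cast; rfl
  rw [this, h.pow_nsmul_mem_iff]
  exact ⟨mem_of_zsmul_mem hm, fun hx => zsmul_mem hx m⟩

theorem IsPComplete.eq_zero_of_zsmul [Fact p.Prime] (h : IsPComplete p X) {n : ℤ} (hn : n ≠ 0)
    {x : X} (hx : n • x = 0) : x = 0 := by
  obtain ⟨j, hj⟩ := h.exists_zsmul_mem_iff hn
  exact h.hausdorff x fun k => (hj k x).1 (hx ▸ zero_mem _)

/-- Elements of a `p`-complete group can be divided by integers prime to `p`. -/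
theorem IsPComplete.exists_zsmul_eq (h : IsPComplete p X) {m : ℤ} (hm : IsCoprime m (p : ℤ))
    (x : X) : ∃ y, m • y = x := by
  have hinv : ∀ k : ℕ, ∃ u : ℤ, (p : ℤ) ^ k ∣ m * u - 1 := fun k => by
    obtain ⟨u, v, huv⟩ := hm.pow_right (n := k)
    exact ⟨u, -v, by linear_combination huv⟩
  choose u hu using hinv
  have hx : ∀ k, m • u k • x - x ∈ powSubgroup p k := fun k => by
    have := zsmul_mem_powSubgroup_of_dvd (hu k) x
    rwa [sub_smul, one_smul, mul_smul] at this
  obtain ⟨y, hy⟩ := h.complete (fun k => u k • x) fun k => by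
    refine mem_of_zsmul_mem hm ?_
    have := sub_mem (powSubgroup_anti (Nat.le_succ k) (hx (k + 1))) (hx k)
    rwa [sub_sub_sub_cancel_right, ← smul_sub] at this
  refine ⟨y, sub_eq_zero.1 (h.hausdorff _ fun k => ?_)⟩
  have := add_mem (zsmul_mem (hy k) m) (hx k)
  rwa [smul_sub, sub_add_sub_cancel] at this

/-- A homomorphism between `p`-complete groups that reflects divisibility by powers of `p` is a
strong embedding. -/
theorem isStrongEmbedding_of_reflects [Fact p.Prime] {M N : Type u} [AddCommGroup M]
    [AddCommGroup N] (hM : IsPComplete p M) (hN : IsPComplete p N) (f : M →+ N)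
    (hf : ∀ k x, f x ∈ powSubgroup p k → x ∈ powSubgroup p k) : IsStrongEmbedding p f := by
  refine ⟨(injective_iff_map_eq_zero f).2 fun x hx => hM.hausdorff x fun k =>
    hf k x (hx ▸ zero_mem _), ?_, ?_⟩
  · rintro n _ ⟨x, rfl⟩ ⟨y, hy⟩
    rcases eq_or_ne n 0 with rfl | hn
    · exact ⟨0, zero_mem _, by rw [← hy, zero_smul, zero_smul]⟩
    -- Reflection of divisibility handles the factor `p ^ j`; completeness of `M` handles the factor
    -- prime to `p`.
    obtain ⟨j, m, rfl, hm⟩ := exists_eq_pow_mul_isCoprime (p := p) hn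
    obtain ⟨x', hx'⟩ := mem_powSubgroup.1 (hf j x (by
      rw [← hy, mul_comm, mul_smul]
      exact zsmul_mem (zsmul_mem_powSubgroup_of_dvd dvd_rfl y) m))
    obtain ⟨z, rfl⟩ := hM.exists_zsmul_eq hm x'
    refine ⟨f z, ⟨z, rfl⟩, ?_⟩
    rw [← hx', ← map_zsmul, mul_smul, ← natCast_zsmul]
    push_cast
    rfl
  · intro y hy
    choose b hb z hz using hy
    choose x hx using hb
    have hy' : ∀ k, y - f (x k) ∈ powSubgroup p k := fun k => by
      rw [hx, hz]; exact nsmul_mem_powSubgroup k _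
    obtain ⟨w, hw⟩ := hM.complete x fun k => hf k _ (by
      have := sub_mem (hy' k) (powSubgroup_anti (Nat.le_succ k) (hy' (k + 1)))
      rwa [sub_sub_sub_cancel_left, ← map_sub] at this)
    refine ⟨w, sub_eq_zero.1 (hN.hausdorff _ fun k => ?_)⟩
    have := sub_mem (map_mem_powSubgroup f (hw k)) (hy' k)
    rwa [map_sub, sub_sub_sub_cancel_right] at this

theorem IsStrongEmbedding.mem_powSubgroup_iff {M N : Type u} [AddCommGroup M] [AddCommGroup N]
    {f : M →+ N} (hf : IsStrongEmbedding p f) {k : ℕ} {x : M} :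
    f x ∈ powSubgroup p k ↔ x ∈ powSubgroup p k := by
  refine ⟨fun h => ?_, map_mem_powSubgroup f⟩
  obtain ⟨y, hy⟩ := mem_powSubgroup.1 h
  have cast : ∀ {Z : Type u} [AddCommGroup Z] (z : Z), ((p ^ k : ℕ) : ℤ) • z = p ^ k • z :=
    fun z => natCast_zsmul z _
  obtain ⟨_, ⟨w, rfl⟩, hw⟩ := hf.2.1 ((p ^ k : ℕ) : ℤ) (f x) ⟨x, rfl⟩ ⟨y, by rw [cast, hy]⟩
  exact mem_powSubgroup.2 ⟨w, hf.1 (by rw [map_nsmul, ← cast, hw])⟩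

/-- The family `e` is independent modulo `p` over the subgroup `G`. -/
def IndepOver (p : ℕ) (G : AddSubgroup X) {J : Type*} (e : J → X) : Prop :=
  ∀ n : J →₀ ℤ, ∀ x ∈ G, Finsupp.linearCombination ℤ e n + x ∈ powSubgroup p 1 →
    ∀ j, (p : ℤ) ∣ n j

/-- The family `e` maps to a basis of `X / p X`. -/
structure IsTopBasis (p : ℕ) {J : Type*} (e : J → X) : Prop where
  indep : IndepOver p ⊥ e
  exists_sub_mem : ∀ x : X, ∃ n : J →₀ ℤ, x - Finsupp.linearCombination ℤ e n ∈ powSubgroup p 1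

theorem exists_eq_zsmul_finsupp {J : Type*} {n : J →₀ ℤ} {c : ℤ} (hn : ∀ j, c ∣ n j) :
    ∃ n' : J →₀ ℤ, n = c • n' := by
  refine ⟨n.mapRange (· / c) (by simp), ?_⟩
  ext j
  simp [Int.mul_ediv_cancel' (hn j)]

theorem zsmul_natCast_eq (x : X) : (p : ℤ) • x = p ^ 1 • x := by
  rw [pow_one, natCast_zsmul]

/-- Over a `p`-pure subgroup, the divisibility of a linear combination of a family independent
modulo `p` is determined by the coefficients. -/
theorem IndepOver.mem_powSubgroup_iff (hX : IsPComplete p X) {G : AddSubgroup X}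
    (hG : ∀ x : X, p • x ∈ G → x ∈ G) {J : Type*} {e : J → X} (he : IndepOver p G e) (r : ℕ) :
    ∀ (n : J →₀ ℤ), ∀ x ∈ G, Finsupp.linearCombination ℤ e n + x ∈ powSubgroup p r ↔
      (∀ j, (p : ℤ) ^ r ∣ n j) ∧ x ∈ powSubgroup p r := by
  have sum_mem : ∀ (r : ℕ) (n : J →₀ ℤ), (∀ j, (p : ℤ) ^ r ∣ n j) →
      Finsupp.linearCombination ℤ e n ∈ powSubgroup p r := fun r n hn => by
    rw [Finsupp.linearCombination_apply]
    exact AddSubgroup.sum_mem _ fun j _ => zsmul_mem_powSubgroup_of_dvd (hn j) _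
  intro n x hx
  refine ⟨?_, fun h => add_mem (sum_mem r n h.1) h.2⟩
  suffices H : Finsupp.linearCombination ℤ e n + x ∈ powSubgroup p r → ∀ j, (p : ℤ) ^ r ∣ n j from
    fun h => ⟨H h, by simpa using sub_mem h (sum_mem r n (H h))⟩
  induction r generalizing n x with
  | zero => simp
  | succ r ih =>
    intro h
    -- Independence extracts a factor `p` from the coefficients, hence also from `x`. After division
    -- by `p` the remainder still lies in `G`, so induction applies.
    have h1 := he n x hx (powSubgroup_anti (by omega) h)
    obtain ⟨n', rfl⟩ := exists_eq_zsmul_finsupp h1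
    have hx1 : x ∈ powSubgroup p 1 := by
      have := sub_mem (powSubgroup_anti (show 1 ≤ r + 1 by omega) h)
        (sum_mem 1 ((p : ℤ) • n') (by simp))
      simpa using this
    obtain ⟨x', rfl⟩ := mem_powSubgroup.1 hx1
    rw [pow_one] at hx
    have := ih n' x' (hG x' hx) (by
      rw [map_smul, zsmul_natCast_eq, ← smul_add, add_comm r 1] at h
      exact hX.pow_nsmul_mem_iff.1 h)
    intro j
    rw [pow_succ', Finsupp.smul_apply, smul_eq_mul]
    exact mul_dvd_mul_left _ (this j)

theorem IsTopBasis.of_addEquiv {J : Type*} {e : J → X} (he : IsTopBasis p e) (φ : X ≃+ Y) :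
    IsTopBasis p (fun j => φ (e j)) := by
  have hφ : ∀ n : J →₀ ℤ, Finsupp.linearCombination ℤ (fun j => φ (e j)) n =
      φ (Finsupp.linearCombination ℤ e n) := fun n => by
    simp [Finsupp.linearCombination_apply, Finsupp.sum, map_sum]
  refine ⟨fun n y hy h => he.indep n 0 (zero_mem _) ?_, fun y => ?_⟩
  · have := map_mem_powSubgroup φ.symm.toAddMonoidHom h
    rw [AddSubgroup.mem_bot.1 hy, hφ] at this
    simpa using this
  · obtain ⟨n, hn⟩ := he.exists_sub_mem (φ.symm y)
    refine ⟨n, ?_⟩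
    have := map_mem_powSubgroup φ.toAddMonoidHom hn
    simpa [hφ] using this

theorem IsTopBasis.exists_sub_mem_pow {J : Type*} {e : J → X} (he : IsTopBasis p e) (x : X)
    (k : ℕ) : ∃ n : J →₀ ℤ, x - Finsupp.linearCombination ℤ e n ∈ powSubgroup p k := by
  induction k with
  | zero => exact ⟨0, mem_powSubgroup_zero _⟩
  | succ k ih =>
    obtain ⟨n, hn⟩ := ih
    obtain ⟨y, hy⟩ := mem_powSubgroup.1 hn
    obtain ⟨m, hm⟩ := he.exists_sub_mem y
    refine ⟨n + (p ^ k : ℕ) • m, ?_⟩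
    have := nsmul_mem_powSubgroup_add (j := k) hm
    rwa [smul_sub, hy, ← map_nsmul, sub_sub, ← map_add] at this

end IsPComplete

/-! ### The completion of a free `ℤ_p`-module is complete and has a topological basis. -/

section FreeCompletion

variable (p : ℕ) [hp : Fact p.Prime]

theorem mem_span_pow_smul_top {F : Type*} [AddCommGroup F] [Module ℤ_[p] F] {k : ℕ} {z : F} :
    z ∈ (Ideal.span {(p : ℤ_[p])} ^ k • ⊤ : Submodule ℤ_[p] F) ↔ z ∈ powSubgroup p k := by
  rw [Ideal.span_singleton_pow, Submodule.ideal_span_singleton_smul,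
    Submodule.mem_smul_pointwise_iff_exists, mem_powSubgroup]
  simp only [Submodule.mem_top, true_and]
  refine exists_congr fun y => ?_
  rw [← Nat.cast_pow, Nat.cast_smul_eq_nsmul]

variable (ι : Type u)

theorem mem_powSubgroup_iff_eval {k : ℕ} {x : FreeCompletion p ι} :
    x ∈ powSubgroup p k ↔
      AdicCompletion.eval (Ideal.span {(p : ℤ_[p])}) (ι →₀ ℤ_[p]) k x = 0 := by
  rw [← mem_span_pow_smul_top, AdicCompletion.pow_smul_top_eq_ker_eval
    (Submodule.fg_span_singleton _), LinearMap.mem_ker]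

theorem of_mem_powSubgroup {k : ℕ} {z : ι →₀ ℤ_[p]} :
    (AdicCompletion.of (Ideal.span {(p : ℤ_[p])}) (ι →₀ ℤ_[p]) z : FreeCompletion p ι) ∈
      powSubgroup p k ↔ z ∈ powSubgroup p k := by
  rw [mem_powSubgroup_iff_eval, AdicCompletion.eval_of, Submodule.mkQ_apply,
    Submodule.Quotient.mk_eq_zero, mem_span_pow_smul_top]

theorem exists_sub_of_mem (x : FreeCompletion p ι) (k : ℕ) :
    ∃ z : ι →₀ ℤ_[p], x - AdicCompletion.of (Ideal.span {(p : ℤ_[p])}) (ι →₀ ℤ_[p]) z ∈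
      powSubgroup p k := by
  obtain ⟨z, hz⟩ := Submodule.mkQ_surjective _
    (AdicCompletion.eval (Ideal.span {(p : ℤ_[p])}) (ι →₀ ℤ_[p]) k x)
  refine ⟨z, ?_⟩
  rw [mem_powSubgroup_iff_eval, map_sub, AdicCompletion.eval_of, hz, sub_self]

theorem isPComplete_freeCompletion : IsPComplete p (FreeCompletion p ι) := by
  have hc : IsAdicComplete (Ideal.span {(p : ℤ_[p])}) (FreeCompletion p ι) :=
    AdicCompletion.isAdicComplete (Submodule.fg_span_singleton _)
  have hh : ∀ x : FreeCompletion p ι, (∀ k, x ∈ powSubgroup p k) → x = 0 := fun x hx =>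
    hc.toIsHausdorff.haus x fun n => by
      rw [SModEq.zero, mem_span_pow_smul_top]; exact hx n
  refine ⟨fun x hx => hh x fun k => ?_, hh, fun u hu => ?_⟩
  -- Torsion-freeness descends to the free module: `z` approximates `x` modulo `p ^ (k + 1)`, the
  -- extra power being lost when `p` is cancelled from `p • z`.
  · obtain ⟨z, hz⟩ := exists_sub_of_mem p ι x (k + 1)
    have h1 : (AdicCompletion.of (Ideal.span {(p : ℤ_[p])}) (ι →₀ ℤ_[p]) (p • z) :
        FreeCompletion p ι) ∈ powSubgroup p (k + 1) := by
      have := nsmul_mem hz p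
      rw [smul_sub, hx, zero_sub, neg_mem_iff] at this
      rwa [map_nsmul]
    obtain ⟨y, hy⟩ := mem_powSubgroup.1 ((of_mem_powSubgroup p ι).1 h1)
    have h2 : z = p ^ k • y := by
      ext i
      have := DFunLike.congr_fun hy i
      simp only [Finsupp.smul_apply, nsmul_eq_mul, Nat.cast_pow] at this ⊢
      rw [pow_succ', mul_assoc] at this
      exact (mul_left_cancel₀ (Nat.cast_ne_zero.2 hp.out.ne_zero) this).symm
    have h3 := (of_mem_powSubgroup p ι (k := k)).2 (h2 ▸ nsmul_mem_powSubgroup k y)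
    have := add_mem (powSubgroup_anti (Nat.le_succ k) hz) h3
    rwa [sub_add_cancel] at this
  · obtain ⟨L, hL⟩ := hc.toIsPrecomplete.prec (f := u) fun {m n} hmn => by
      rw [SModEq.sub_mem, mem_span_pow_smul_top]
      induction n, hmn using Nat.le_induction with
      | base => rw [sub_self]; exact zero_mem _
      | succ n hmn ih =>
        have := sub_mem ih (powSubgroup_anti hmn (hu n))
        rwa [sub_sub, add_sub_cancel] at this
    refine ⟨L, fun k => ?_⟩
    have := (hL k).symm
    rwa [SModEq.sub_mem, mem_span_pow_smul_top] at this

theorem dvd_of_intCast_eq_mul {n : ℤ} {y : ℤ_[p]} (h : (n : ℤ_[p]) = p * y) : (p : ℤ) ∣ n := by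
  simpa using (PadicInt.pow_p_dvd_int_iff 1 n).1 ⟨y, by simpa using h⟩

theorem isTopBasis_freeCompletion : IsTopBasis p (fun i : ι =>
    (AdicCompletion.of (Ideal.span {(p : ℤ_[p])}) (ι →₀ ℤ_[p]) (Finsupp.single i 1) :
      FreeCompletion p ι)) := by
  have hlc : ∀ n : ι →₀ ℤ, Finsupp.linearCombination ℤ (fun i : ι =>
      (AdicCompletion.of (Ideal.span {(p : ℤ_[p])}) (ι →₀ ℤ_[p]) (Finsupp.single i 1) :
        FreeCompletion p ι)) n = AdicCompletion.of (Ideal.span {(p : ℤ_[p])}) (ι →₀ ℤ_[p])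
          (n.mapRange (Int.cast : ℤ → ℤ_[p]) Int.cast_zero) := fun n => by
    induction n using Finsupp.induction_linear with
    | zero => simp
    | add f g hf hg =>
      rw [map_add, hf, hg, ← map_add, Finsupp.mapRange_add (fun x y => Int.cast_add x y)]
    | single i m =>
      rw [Finsupp.linearCombination_single, ← map_zsmul, Finsupp.mapRange_single]
      congr 1
      simp
  refine ⟨fun n x hx h j => ?_, fun x => ?_⟩
  · rw [AddSubgroup.mem_bot.1 hx, add_zero, hlc, of_mem_powSubgroup] at h
    obtain ⟨y, hy⟩ := mem_powSubgroup.1 h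
    refine dvd_of_intCast_eq_mul p (y := y j) ?_
    have := DFunLike.congr_fun hy j
    simpa using this.symm
  · obtain ⟨z, hz⟩ := exists_sub_of_mem p ι x 1
    suffices H : ∃ n : ι →₀ ℤ, AdicCompletion.of (Ideal.span {(p : ℤ_[p])}) (ι →₀ ℤ_[p]) z -
        Finsupp.linearCombination ℤ (fun i : ι => (AdicCompletion.of (Ideal.span {(p : ℤ_[p])})
          (ι →₀ ℤ_[p]) (Finsupp.single i 1) : FreeCompletion p ι)) n ∈ powSubgroup p 1 by
      obtain ⟨n, hn⟩ := H
      refine ⟨n, ?_⟩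
      have := add_mem hz hn
      rwa [sub_add_sub_cancel] at this
    clear hz
    induction z using Finsupp.induction_linear with
    | zero => exact ⟨0, by simp⟩
    | add f g hf hg =>
      obtain ⟨n, hn⟩ := hf
      obtain ⟨m, hm⟩ := hg
      refine ⟨n + m, ?_⟩
      have := add_mem hn hm
      rwa [sub_add_sub_comm, ← map_add, ← map_add] at this
    | single i c =>
      obtain ⟨n, -, hn⟩ := PadicInt.exists_mem_range c
      rw [PadicInt.maximalIdeal_eq_span_p, Ideal.mem_span_singleton] at hn
      obtain ⟨d, hd⟩ := hn
      refine ⟨Finsupp.single i (n : ℤ), ?_⟩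
      rw [hlc, ← map_sub, of_mem_powSubgroup, Finsupp.mapRange_single, ← Finsupp.single_sub]
      refine mem_powSubgroup.2 ⟨Finsupp.single i d, ?_⟩
      rw [Finsupp.smul_single]
      congr 1
      simpa using hd.symm

end FreeCompletion

/-! ### Intrinsic description of the class. -/

section Classification

variable {p : ℕ}

theorem IsPComplete.exists_limit {X J : Type*} [AddCommGroup X] (hX : IsPComplete p X)
    (e : J → X) (n : ℕ → J →₀ ℤ) (hn : ∀ k j, (p : ℤ) ^ k ∣ (n (k + 1) - n k) j) :
    ∃ x, ∀ k, x - Finsupp.linearCombination ℤ e (n k) ∈ powSubgroup p k :=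
  hX.complete _ fun k => by
    rw [← map_sub, Finsupp.linearCombination_apply]
    exact AddSubgroup.sum_mem _ fun j _ => zsmul_mem_powSubgroup_of_dvd (hn k j) _

theorem IsTopBasis.dvd_iff {X J : Type*} [AddCommGroup X] (hX : IsPComplete p X)
    {e : J → X} (he : IsTopBasis p e) {k : ℕ} {n : J →₀ ℤ} :
    Finsupp.linearCombination ℤ e n ∈ powSubgroup p k ↔ ∀ j, (p : ℤ) ^ k ∣ n j := by
  have := he.indep.mem_powSubgroup_iff hX
    (fun x hx => AddSubgroup.mem_bot.2 (hX.torsionFree x (AddSubgroup.mem_bot.1 hx))) k n 0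
    (zero_mem _)
  simpa [zero_mem] using this

/-- Elements of two groups that have the same `p`-adic expansions in two given families. -/
def expansionGraph (p : ℕ) {X Y J : Type*} [AddCommGroup X] [AddCommGroup Y]
    (e : J → X) (f : J → Y) : AddSubgroup (X × Y) where
  carrier := {z | ∀ k, ∃ n : J →₀ ℤ, z.1 - Finsupp.linearCombination ℤ e n ∈ powSubgroup p k ∧
    z.2 - Finsupp.linearCombination ℤ f n ∈ powSubgroup p k}
  zero_mem' k := ⟨0, by simp [zero_mem], by simp [zero_mem]⟩
  add_mem' {a b} ha hb k := by
    obtain ⟨n, hn, hn'⟩ := ha k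
    obtain ⟨m, hm, hm'⟩ := hb k
    refine ⟨n + m, ?_, ?_⟩
    · simpa [add_sub_add_comm] using add_mem hn hm
    · simpa [add_sub_add_comm] using add_mem hn' hm'
  neg_mem' {a} ha k := by
    obtain ⟨n, hn, hn'⟩ := ha k
    refine ⟨-n, ?_, ?_⟩
    · simpa [neg_add_eq_sub] using neg_mem hn
    · simpa [neg_add_eq_sub] using neg_mem hn'

/-- Divisibility of a finite combination depends only on its coefficients, equally for `e` and `f`.
So an expansion of `0` in `X` is an expansion of `0` in `Y`, and a convergent expansion in `X`
converges in `Y`. -/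
theorem bijective_fst_expansionGraph {X Y J : Type*} [AddCommGroup X] [AddCommGroup Y]
    (hX : IsPComplete p X) (hY : IsPComplete p Y) {e : J → X} {f : J → Y}
    (he : IsTopBasis p e) (hf : IsTopBasis p f) :
    Function.Bijective ((AddMonoidHom.fst X Y).comp (expansionGraph p e f).subtype) := by
  constructor
  · rw [injective_iff_map_eq_zero]
    rintro ⟨⟨x, y⟩, h⟩ (rfl : x = 0)
    suffices y = 0 by subst this; rfl
    refine hY.hausdorff y fun k => ?_
    obtain ⟨n, hn, hn'⟩ := h k
    dsimp only at hn hn'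
    rw [zero_sub, neg_mem_iff, he.dvd_iff hX, ← hf.dvd_iff hY] at hn
    simpa using add_mem hn' hn
  · intro x
    choose n hn using he.exists_sub_mem_pow x
    have hdvd : ∀ k j, (p : ℤ) ^ k ∣ (n (k + 1) - n k) j := fun k => by
      rw [← he.dvd_iff hX, map_sub]
      have := sub_mem (hn k) (powSubgroup_anti (Nat.le_succ k) (hn (k + 1)))
      rwa [sub_sub_sub_cancel_left] at this
    obtain ⟨y, hy⟩ := hY.exists_limit f n hdvd
    exact ⟨⟨(x, y), fun k => ⟨n k, hn k, hy k⟩⟩, rfl⟩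

theorem nonempty_addEquiv_of_isTopBasis {X Y J : Type*} [AddCommGroup X] [AddCommGroup Y]
    (hX : IsPComplete p X) (hY : IsPComplete p Y) {e : J → X} {f : J → Y}
    (he : IsTopBasis p e) (hf : IsTopBasis p f) : Nonempty (X ≃+ Y) := by
  have h1 := AddEquiv.ofBijective _ (bijective_fst_expansionGraph hX hY he hf)
  have h2 := AddEquiv.ofBijective _ (bijective_fst_expansionGraph hY hX hf he)
  have h3 : expansionGraph p e f ≃+ expansionGraph p f e :=
    { toFun := fun z => ⟨(z.1.2, z.1.1), fun k => by
        obtain ⟨n, h, h'⟩ := z.2 k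
        exact ⟨n, h', h⟩⟩
      invFun := fun z => ⟨(z.1.2, z.1.1), fun k => by
        obtain ⟨n, h, h'⟩ := z.2 k
        exact ⟨n, h', h⟩⟩
      left_inv := fun _ => rfl
      right_inv := fun _ => rfl
      map_add' := fun _ _ => rfl }
  exact ⟨h1.symm.trans (h3.trans h2)⟩

/-- Lifts of an `𝔽_p`-basis of `X / p X` form a topological basis. -/
theorem exists_isTopBasis_of_ker [Fact p.Prime] {X : Type*} {V : Type u} [AddCommGroup X]
    [AddCommGroup V] [Module (ZMod p) V] (π : X →+ V) (hπ : Function.Surjective π)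
    (hker : ∀ x, π x = 0 ↔ x ∈ powSubgroup p 1) : ∃ (J : Type u) (e : J → X), IsTopBasis p e := by
  let b := Module.Basis.ofVectorSpace (ZMod p) V
  choose e he using fun j => hπ (b j)
  have key : ∀ n : Module.Basis.ofVectorSpaceIndex (ZMod p) V →₀ ℤ,
      π (Finsupp.linearCombination ℤ e n) = Finsupp.linearCombination (ZMod p) b
        (n.mapRange (Int.cast : ℤ → ZMod p) Int.cast_zero) := fun n => by
    induction n using Finsupp.induction_linear with
    | zero => simp
    | add f g hf hg =>
      rw [map_add, map_add, hf, hg, ← map_add, Finsupp.mapRange_add (fun x y => Int.cast_add x y)]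
    | single i m =>
      rw [Finsupp.linearCombination_single, Finsupp.mapRange_single,
        Finsupp.linearCombination_single, map_zsmul, he, Int.cast_smul_eq_zsmul]
  refine ⟨_, e, fun n x hx h j => ?_, fun x => ?_⟩
  · rw [AddSubgroup.mem_bot.1 hx, add_zero, ← hker, key] at h
    have := DFunLike.congr_fun (linearIndependent_iff.1 b.linearIndependent _ h) j
    simpa [ZMod.intCast_zmod_eq_zero_iff_dvd] using this
  · obtain ⟨n, hn⟩ := Finsupp.mapRange_surjective (α := Module.Basis.ofVectorSpaceIndex (ZMod p) V)
      (Int.cast : ℤ → ZMod p) Int.cast_zero ZMod.intCast_surjective (b.repr (π x))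
    refine ⟨n, ?_⟩
    rw [← hker, map_sub, key, hn, b.linearCombination_repr, sub_self]

theorem exists_isTopBasis (p : ℕ) [Fact p.Prime] (X : Type u) [AddCommGroup X] :
    ∃ (J : Type u) (e : J → X), IsTopBasis p e := by
  let := AddCommGroup.zmodModule (n := p) (G := X ⧸ (powSubgroup p 1 : AddSubgroup X)) fun v => by
    induction v using QuotientAddGroup.induction_on with
    | H x =>
      rw [← QuotientAddGroup.mk_nsmul, QuotientAddGroup.eq_zero_iff]
      simpa using nsmul_mem_powSubgroup (p := p) 1 x
  exact exists_isTopBasis_of_ker (QuotientAddGroup.mk' _) (QuotientAddGroup.mk'_surjective _)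
    fun x => QuotientAddGroup.eq_zero_iff x

theorem inClass_iff_isPComplete [Fact p.Prime] {M : Type u} [AddCommGroup M] :
    InClass p M ↔ IsPComplete p M := by
  constructor
  · rintro ⟨ι, ⟨φ⟩⟩
    exact (isPComplete_freeCompletion p ι).of_addEquiv φ.symm
  · intro h
    obtain ⟨J, e, he⟩ := exists_isTopBasis p M
    exact ⟨J, nonempty_addEquiv_of_isTopBasis h (isPComplete_freeCompletion p J) he
      (isTopBasis_freeCompletion p J)⟩

end Classification

/-! ### Products, and quotients by closed pure hulls. -/

section Hull

variable {p : ℕ} {X Y : Type*} [AddCommGroup X] [AddCommGroup Y]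

theorem mem_powSubgroup_prod {k : ℕ} {z : X × Y} :
    z ∈ powSubgroup p k ↔ z.1 ∈ powSubgroup p k ∧ z.2 ∈ powSubgroup p k := by
  refine ⟨fun h => ⟨map_mem_powSubgroup (AddMonoidHom.fst X Y) h,
    map_mem_powSubgroup (AddMonoidHom.snd X Y) h⟩, fun ⟨h1, h2⟩ => ?_⟩
  obtain ⟨x, hx⟩ := mem_powSubgroup.1 h1
  obtain ⟨y, hy⟩ := mem_powSubgroup.1 h2
  exact mem_powSubgroup.2 ⟨(x, y), Prod.ext hx hy⟩

theorem IsPComplete.prod (hX : IsPComplete p X) (hY : IsPComplete p Y) :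
    IsPComplete p (X × Y) where
  torsionFree z hz := Prod.ext (hX.torsionFree _ (congrArg Prod.fst hz))
    (hY.torsionFree _ (congrArg Prod.snd hz))
  hausdorff z hz := Prod.ext (hX.hausdorff _ fun k => (mem_powSubgroup_prod.1 (hz k)).1)
    (hY.hausdorff _ fun k => (mem_powSubgroup_prod.1 (hz k)).2)
  complete u hu := by
    obtain ⟨x, hx⟩ := hX.complete (fun k => (u k).1) fun k => (mem_powSubgroup_prod.1 (hu k)).1
    obtain ⟨y, hy⟩ := hY.complete (fun k => (u k).2) fun k => (mem_powSubgroup_prod.1 (hu k)).2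
    exact ⟨(x, y), fun k => mem_powSubgroup_prod.2 ⟨hx k, hy k⟩⟩

/-- The closed pure hull of a subgroup. -/
def closedHull (p : ℕ) (L : AddSubgroup X) : AddSubgroup X where
  carrier := {x | ∀ k, ∃ j, ∃ z ∈ L, p ^ j • x - z ∈ powSubgroup p (j + k)}
  zero_mem' k := ⟨0, 0, zero_mem _, by simp [zero_mem]⟩
  add_mem' {x y} hx hy k := by
    obtain ⟨i, z, hz, h⟩ := hx k
    obtain ⟨j, w, hw, h'⟩ := hy k
    refine ⟨i + j, p ^ j • z + p ^ i • w, add_mem (nsmul_mem hz _) (nsmul_mem hw _), ?_⟩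
    have h1 := nsmul_mem_powSubgroup_add (j := j) h
    have h2 := nsmul_mem_powSubgroup_add (j := i) h'
    rw [smul_sub, ← mul_smul, ← pow_add] at h1 h2
    rw [← add_assoc, add_comm j i] at h1
    rw [← add_assoc] at h2
    have := add_mem h1 h2
    rwa [sub_add_sub_comm, ← smul_add] at this
  neg_mem' {x} hx k := by
    obtain ⟨i, z, hz, h⟩ := hx k
    refine ⟨i, -z, neg_mem hz, ?_⟩
    have := neg_mem h
    rwa [neg_sub', ← smul_neg] at this

theorem le_closedHull (L : AddSubgroup X) : L ≤ closedHull p L := fun x hx k =>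
  ⟨0, x, hx, by simp [zero_mem]⟩

theorem mk_mem_powSubgroup (H : AddSubgroup X) {k : ℕ} {x : X} :
    (x : X ⧸ H) ∈ powSubgroup p k ↔ ∃ y, x - p ^ k • y ∈ H := by
  rw [mem_powSubgroup, QuotientAddGroup.mk_surjective.exists]
  refine exists_congr fun y => ?_
  rw [← QuotientAddGroup.mk_nsmul, eq_comm, ← sub_eq_zero, ← QuotientAddGroup.mk_sub,
    QuotientAddGroup.eq_zero_iff]

/-- Belonging to the hull means being approximated to every precision by formal quotients `z / p ^
j` with `z ∈ L`. Purity of the hull gives torsion-freeness, and its closedness gives the Hausdorff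
property. -/
theorem IsPComplete.quotient (hX : IsPComplete p X) (L : AddSubgroup X) :
    IsPComplete p (X ⧸ closedHull p L) where
  torsionFree x hx := by
    induction x using QuotientAddGroup.induction_on with
    | H x =>
      rw [← QuotientAddGroup.mk_nsmul, QuotientAddGroup.eq_zero_iff] at hx
      rw [QuotientAddGroup.eq_zero_iff]
      intro k
      obtain ⟨j, z, hz, h⟩ := hx (k + 1)
      refine ⟨j + 1, z, hz, ?_⟩
      rwa [← mul_smul, ← pow_succ, ← add_assoc, add_right_comm] at h
  hausdorff x hx := by
    induction x using QuotientAddGroup.induction_on with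
    | H x =>
      rw [QuotientAddGroup.eq_zero_iff]
      intro k
      obtain ⟨y, hy⟩ := (mk_mem_powSubgroup _).1 (hx k)
      obtain ⟨j, z, hz, h⟩ := hy k
      refine ⟨j, z, hz, ?_⟩
      have := add_mem h (nsmul_mem_powSubgroup_add (j := j) (nsmul_mem_powSubgroup k y))
      rwa [smul_sub, sub_right_comm, sub_add_cancel] at this
  complete u hu := by
    choose v hv using fun k => mem_powSubgroup.1 (hu k)
    choose y hy using fun k => QuotientAddGroup.mk_surjective (v k)
    obtain ⟨x₀, hx₀⟩ := QuotientAddGroup.mk_surjective (u 0)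
    -- Lifting the increments rather than the terms makes the lifted sequence Cauchy in `X`.
    let w : ℕ → X := fun k => x₀ + ∑ i ∈ Finset.range k, p ^ i • y i
    have hw : ∀ k, (w k : X ⧸ closedHull p L) = u k := fun k => by
      induction k with
      | zero => simpa [w] using hx₀
      | succ k ih =>
        have h1 : w (k + 1) = w k + p ^ k • y k := by
          simp [w, Finset.sum_range_succ, add_assoc]
        rw [h1, QuotientAddGroup.mk_add, ih, QuotientAddGroup.mk_nsmul, hy, hv, add_sub_cancel]
    obtain ⟨x, hx⟩ := hX.complete w fun k => by
      simp [w, Finset.sum_range_succ, nsmul_mem_powSubgroup]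
    refine ⟨x, fun k => ?_⟩
    have := map_mem_powSubgroup (QuotientAddGroup.mk' (closedHull p L)) (hx k)
    rwa [map_sub, QuotientAddGroup.mk'_apply, QuotientAddGroup.mk'_apply, hw] at this

theorem IndepOver.comp {G : AddSubgroup X} {J K : Type*} {e : J → X} (he : IndepOver p G e)
    {h : K → J} (hh : Function.Injective h) : IndepOver p G (e ∘ h) := fun n x hx hn j => by
  have := he (n.embDomain ⟨h, hh⟩) x hx (by rwa [Finsupp.linearCombination_embDomain]) (h j)
  rwa [show h j = (⟨h, hh⟩ : K ↪ J) j from rfl, Finsupp.embDomain_apply_self] at this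

theorem linearCombination_add_nsmul {I : Type*} (c e : I → X) (m : ℕ) (n : I →₀ ℤ) :
    Finsupp.linearCombination ℤ (fun i => c i + m • e i) n =
      Finsupp.linearCombination ℤ e (m • n) + Finsupp.linearCombination ℤ c n := by
  rw [map_nsmul]
  simp only [Finsupp.linearCombination_apply, Finsupp.sum, smul_add, Finset.sum_add_distrib,
    Finset.smul_sum]
  rw [add_comm]
  simp only [smul_comm m]

theorem exists_linearCombination_sumElim {I J : Type*} [Fintype I] [Fintype J]
    (n : I ⊕ J →₀ ℤ) : ∃ (n₁ : I →₀ ℤ) (n₂ : J →₀ ℤ), ∀ (a : I → X) (b : J → X),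
      Finsupp.linearCombination ℤ (Sum.elim a b) n =
        Finsupp.linearCombination ℤ a n₁ + Finsupp.linearCombination ℤ b n₂ :=
  ⟨Finsupp.equivFunOnFinite.symm fun i => n (Sum.inl i),
    Finsupp.equivFunOnFinite.symm fun j => n (Sum.inr j), fun a b => by
      simp [Finsupp.linearCombination_apply, Finsupp.sum_fintype]⟩

end Hull

/-! ### Galois types as divisibility data, and strong splitting. -/

section SameType

variable {p : ℕ} [Fact p.Prime] {M : Type u} [AddCommGroup M] {I : Type*}

/-- The relations to impose on `M × M` in order to amalgamate two copies of `M` along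
`A ∪ {a i}` and `A ∪ {b i}`. -/
def amalgamRelations (A : Set M) (a b : I → M) : AddSubgroup (M × M) where
  carrier := {z | ∃ n : I →₀ ℤ, ∃ x ∈ AddSubgroup.closure A,
    z = (Finsupp.linearCombination ℤ a n + x, -(Finsupp.linearCombination ℤ b n + x))}
  zero_mem' := ⟨0, 0, zero_mem _, by simp [Prod.ext_iff]⟩
  add_mem' := by
    rintro _ _ ⟨n, x, hx, rfl⟩ ⟨m, y, hy, rfl⟩
    refine ⟨n + m, x + y, add_mem hx hy, Prod.ext ?_ ?_⟩ <;>
    · simp only [Prod.mk_add_mk, map_add]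
      abel
  neg_mem' := by
    rintro _ ⟨n, x, hx, rfl⟩
    refine ⟨-n, -x, neg_mem hx, Prod.ext ?_ ?_⟩ <;>
    · simp only [Prod.neg_mk, map_neg]
      abel

/-- Two tuples have the same Galois type over `A` if and only if the corresponding integral
combinations with elements of `⟨A⟩` are divisible by the same powers of `p`. -/
theorem sameType_iff (hM : IsPComplete p M) {A : Set M} {a b : I → M} :
    SameType p A a b ↔ ∀ (n : I →₀ ℤ), ∀ x ∈ AddSubgroup.closure A, ∀ k,
      (Finsupp.linearCombination ℤ a n + x ∈ powSubgroup p k ↔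
        Finsupp.linearCombination ℤ b n + x ∈ powSubgroup p k) := by
  constructor
  · rintro ⟨N, _, -, f, g, hf, hg, hA, hab⟩ n x hx k
    have hx' : f x = g x := by
      have : AddSubgroup.closure A ≤ f.eqLocus g := (AddSubgroup.closure_le _).2 hA
      exact this hx
    have hn : f (Finsupp.linearCombination ℤ a n) = g (Finsupp.linearCombination ℤ b n) := by
      simp [Finsupp.linearCombination_apply, Finsupp.sum, map_sum, hab]
    rw [← hf.mem_powSubgroup_iff, ← hg.mem_powSubgroup_iff, map_add, map_add, hx', hn]
  · intro H
    let L := closedHull p (amalgamRelations A a b)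
    have hN : IsPComplete p ((M × M) ⧸ L) := (hM.prod hM).quotient _
    -- If `w` becomes divisible by `p ^ k` in the quotient, then `p ^ j • w` agrees modulo `p ^ (j +
    -- k)` with a relation, whose two components are equally divisible by `H`. For `w = (x, 0)` or
    -- `(0, x)` one component is divisible, hence the other, hence `x`.
    have key : ∀ k (w : M × M), (w : (M × M) ⧸ L) ∈ powSubgroup p k →
        ∃ j u v, (u ∈ powSubgroup p (j + k) ↔ v ∈ powSubgroup p (j + k)) ∧
          p ^ j • w.1 - u ∈ powSubgroup p (j + k) ∧ p ^ j • w.2 - v ∈ powSubgroup p (j + k) := by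
      intro k w hw
      obtain ⟨y, hy⟩ := (mk_mem_powSubgroup _).1 hw
      obtain ⟨j, _, ⟨n, x, hx, rfl⟩, h⟩ := hy k
      have := add_mem h (nsmul_mem_powSubgroup_add (j := j) (nsmul_mem_powSubgroup k y))
      rw [smul_sub, sub_right_comm, sub_add_cancel] at this
      exact ⟨j, _, _, (H n x hx (j + k)).trans neg_mem_iff.symm, mem_powSubgroup_prod.1 this⟩
    refine ⟨_, _, inClass_iff_isPComplete.2 hN,
      (QuotientAddGroup.mk' L).comp (AddMonoidHom.inl M M),
      (QuotientAddGroup.mk' L).comp (AddMonoidHom.inr M M),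
      isStrongEmbedding_of_reflects hM hN _ fun k x hx => ?_,
      isStrongEmbedding_of_reflects hM hN _ fun k x hx => ?_, fun x hx => ?_, fun i => ?_⟩
    · obtain ⟨j, u, v, huv, h1, h2⟩ := key k (x, 0) hx
      have hv : v ∈ powSubgroup p (j + k) := by simpa using h2
      exact hM.pow_nsmul_mem_iff.1 (by simpa using add_mem h1 (huv.2 hv))
    · obtain ⟨j, u, v, huv, h1, h2⟩ := key k (0, x) hx
      have hu : u ∈ powSubgroup p (j + k) := by simpa using h1
      exact hM.pow_nsmul_mem_iff.1 (by simpa using add_mem h2 (huv.1 hu))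
    · refine (QuotientAddGroup.eq_iff_sub_mem).2 (le_closedHull _ ?_)
      exact ⟨0, x, AddSubgroup.subset_closure hx, by simp⟩
    · refine (QuotientAddGroup.eq_iff_sub_mem).2 (le_closedHull _ ?_)
      exact ⟨Finsupp.single i 1, 0, zero_mem _, by simp⟩

theorem SameType.refl (hM : IsPComplete p M) (A : Set M) (a : I → M) : SameType p A a a :=
  (sameType_iff hM).2 fun _ _ _ _ => Iff.rfl

/-- The pure subgroup generated by `A`, as a subgroup. -/
def pureClosure (A : Set M) : AddSubgroup M where
  carrier := pcl A
  zero_mem' := ⟨1, one_pos, by simp [zero_mem]⟩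
  add_mem' := by
    rintro x y ⟨n, hn, hx⟩ ⟨m, hm, hy⟩
    refine ⟨n * m, Nat.mul_pos hn hm, ?_⟩
    have := add_mem (nsmul_mem hx m) (nsmul_mem hy n)
    rwa [← mul_smul, ← mul_smul, mul_comm m n, ← smul_add] at this
  neg_mem' := by
    rintro x ⟨n, hn, hx⟩
    exact ⟨n, hn, by rw [smul_neg]; exact neg_mem hx⟩

theorem mem_pureClosure {A : Set M} {x : M} :
    x ∈ pureClosure A ↔ ∃ n : ℕ, 0 < n ∧ n • x ∈ AddSubgroup.closure A := Iff.rfl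

theorem subset_pureClosure (A : Set M) : A ⊆ pureClosure A := fun x hx =>
  ⟨1, one_pos, by rw [one_smul]; exact AddSubgroup.subset_closure hx⟩

theorem pureClosure_mono {A B : Set M} (h : A ⊆ B) : pureClosure A ≤ pureClosure B :=
  fun _ ⟨n, hn, hx⟩ => ⟨n, hn, AddSubgroup.closure_mono h hx⟩

theorem mem_pureClosure_of_nsmul {A : Set M} {x : M} (hx : p • x ∈ pureClosure A) :
    x ∈ pureClosure A := by
  obtain ⟨n, hn, h⟩ := hx
  exact ⟨n * p, Nat.mul_pos hn (Fact.out : p.Prime).pos, by rwa [mul_smul]⟩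

theorem exists_finite_of_mem_pureClosure {A : Set M} {x : M} (hx : x ∈ pureClosure A) :
    ∃ F ⊆ A, F.Finite ∧ x ∈ pureClosure F := by
  obtain ⟨n, hn, h⟩ := hx
  suffices H : ∃ F ⊆ A, F.Finite ∧ n • x ∈ AddSubgroup.closure F by
    obtain ⟨F, hFA, hF, h⟩ := H
    exact ⟨F, hFA, hF, n, hn, h⟩
  generalize n • x = y at h
  induction h using AddSubgroup.closure_induction with
  | mem y hy => exact ⟨{y}, by simpa using hy, Set.finite_singleton y,
      AddSubgroup.subset_closure rfl⟩
  | zero => exact ⟨∅, Set.empty_subset _, Set.finite_empty, zero_mem _⟩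
  | add y z _ _ hy hz =>
    obtain ⟨F, hFA, hF, h⟩ := hy
    obtain ⟨F', hFA', hF', h'⟩ := hz
    exact ⟨F ∪ F', Set.union_subset hFA hFA', hF.union hF',
      add_mem (AddSubgroup.closure_mono Set.subset_union_left h)
        (AddSubgroup.closure_mono Set.subset_union_right h')⟩
  | neg y _ hy =>
    obtain ⟨F, hFA, hF, h⟩ := hy
    exact ⟨F, hFA, hF, neg_mem h⟩

/-- The type over `A` also controls parameters in `⟨A⟩_P`: clearing the denominator shifts every
divisibility exponent by the same amount. -/
theorem SameType.mem_powSubgroup_iff (hM : IsPComplete p M) {A : Set M} {a b : I → M}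
    (h : SameType p A a b) (n : I →₀ ℤ) {x : M} (hx : x ∈ pureClosure A) (k : ℕ) :
    Finsupp.linearCombination ℤ a n + x ∈ powSubgroup p k ↔
      Finsupp.linearCombination ℤ b n + x ∈ powSubgroup p k := by
  obtain ⟨N, hN, hNx⟩ := hx
  obtain ⟨j, hj⟩ := hM.exists_zsmul_mem_iff (n := (N : ℤ)) (by exact_mod_cast hN.ne')
  rw [← hj k (_ + x), ← hj k (Finsupp.linearCombination ℤ b n + x), smul_add, smul_add, ← map_smul, ← map_smul]
  exact (sameType_iff hM).1 h _ _ ((natCast_zsmul x N).symm ▸ hNx) _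

/-- Translates by elements of `G` of multiples by `p ^ m` of families independent over `G` have
the same type over subsets of `G`. -/
theorem sameType_of_indepOver (hM : IsPComplete p M) {G : AddSubgroup M}
    (hG : ∀ x : M, p • x ∈ G → x ∈ G) {C : Set M} (hC : C ⊆ G) {e e' c : I → M}
    (he : IndepOver p G e) (he' : IndepOver p G e') (hc : ∀ i, c i ∈ G) (m : ℕ) :
    SameType p C (fun i => c i + p ^ m • e i) (fun i => c i + p ^ m • e' i) := by
  refine (sameType_iff hM).2 fun n x hx k => ?_
  have hx' : Finsupp.linearCombination ℤ c n + x ∈ G := by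
    refine add_mem ?_ ((AddSubgroup.closure_le _).2 hC hx)
    rw [Finsupp.linearCombination_apply]
    exact sum_mem fun i _ => zsmul_mem (hc i) _
  rw [linearCombination_add_nsmul, linearCombination_add_nsmul, add_assoc, add_assoc,
    he.mem_powSubgroup_iff hM hG _ _ _ hx', he'.mem_powSubgroup_iff hM hG _ _ _ hx']

theorem IndepOver.sub_notMem {G : AddSubgroup M} {J : Type*} {e : J → M} (he : IndepOver p G e)
    {i j : J} (hij : i ≠ j) : e i - e j ∉ powSubgroup p 1 := fun h => by
  have := he (Finsupp.single i 1 - Finsupp.single j 1) 0 (zero_mem _) (by simpa using h) i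
  rw [Finsupp.sub_apply, Finsupp.single_eq_same, Finsupp.single_eq_of_ne hij, sub_zero] at this
  exact (Nat.prime_iff_prime_int.1 (Fact.out : p.Prime)).not_dvd_one this

/-- A single element outside `p M + G` is independent over `G`. -/
theorem indepOver_of_forall_notMem {G : AddSubgroup M} {e : Fin 1 → M}
    (he : ∀ x ∈ G, e 0 + x ∉ powSubgroup p 1) : IndepOver p G e := by
  intro n x hx h j
  rw [Subsingleton.elim j 0]
  by_contra hn
  have hcop : IsCoprime (n 0) (p : ℤ) :=
    ((Prime.coprime_iff_not_dvd (Nat.prime_iff_prime_int.1 Fact.out)).2 hn).symm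
  obtain ⟨u, v, huv⟩ := hcop
  refine he (u • x) (zsmul_mem hx u) ?_
  have h1 : e 0 + u • x = u • (n 0 • e 0 + x) + (v * p) • e 0 := by
    rw [smul_add, add_right_comm, ← mul_smul, ← add_smul, huv, one_smul]
  rw [h1]
  refine add_mem (zsmul_mem ?_ u) (zsmul_mem_powSubgroup_of_dvd (by simp) _)
  simpa [Finsupp.linearCombination_apply, Finsupp.sum_fintype] using h

theorem splitsStrongly_of_indepOver (hM : IsPComplete p M) {G : AddSubgroup M}
    (hG : ∀ x : M, p • x ∈ G → x ∈ G) {C D : Set M} (hC : C ⊆ G) {e : ℕ → M}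
    (he : IndepOver p G e) {c : M} (hc : c ∈ G) (m : ℕ) (b : Fin 1 → M)
    (hb : b 0 - (c + p ^ m • e 0) ∈ powSubgroup p (m + 1)) (h0 : c + p ^ m • e 0 ∈ D)
    (h1 : c + p ^ m • e 1 ∈ D) : SplitsStrongly p b D C := by
  refine ⟨1, fun i _ => c + p ^ m • e i, fun k i j hi hj => ?_, fun _ => h0, fun _ => h1,
    fun H => ?_⟩
  · have inj : ∀ i : Fin k → ℕ, StrictMono i →
        Function.Injective (fun q : Fin k × Fin 1 => i q.1) := fun i hi q q' h =>
      Prod.ext (hi.injective h) (Subsingleton.elim _ _)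
    exact sameType_of_indepOver hM hG hC (he.comp (inj i hi)) (he.comp (inj j hj))
      (c := fun _ => c) (fun _ => hc) m
  -- Equal types would make `b 0` congruent to both terms modulo `p ^ (m + 1)`, forcing `e 0 - e 1`
  -- to be divisible by `p`.
  · have h2 := (H.mem_powSubgroup_iff hM (Finsupp.single (Sum.inl 0) 1 -
      Finsupp.single (Sum.inr 0) 1) (zero_mem _) (m + 1)).1 (by simpa using hb)
    have h3 := sub_mem h2 hb
    refine he.sub_notMem (zero_ne_one) (hM.pow_nsmul_mem_iff (j := m) |>.1 ?_)
    rw [smul_sub]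
    convert h3 using 1
    simp

theorem IsIndiscernible.sameType {C : Set M} {m : ℕ} {s : ℕ → Fin m → M}
    (hs : IsIndiscernible p C s) (i j : ℕ) : SameType p C (s i) (s j) := by
  obtain ⟨N, _, hN, f, g, hf, hg, hC, h⟩ := hs 1 (fun _ => i) (fun _ => j)
    (Subsingleton.strictMono _) (Subsingleton.strictMono _)
  exact ⟨N, _, hN, f, g, hf, hg, hC, fun l => h (0, l)⟩

/-- If `b = c + p ^ k e` with `c` in the pure closure of `C` and `e` independent over the pure
closure of `D`, then the type of `b` over `D` does not split strongly over `C`. -/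
theorem not_splitsStrongly_of_indepOver (hM : IsPComplete p M) {C D : Set M} (hCD : C ⊆ D)
    {e : Fin 1 → M} (he : IndepOver p (pureClosure D) e) {c : M} (hc : c ∈ pureClosure C)
    (k : ℕ) : ¬ SplitsStrongly p (fun i => c + p ^ k • e i) D C := by
  rintro ⟨m, s, hs, h0, h1, H⟩
  refine H ((sameType_iff hM).2 fun n x hx r => ?_)
  obtain ⟨n₁, n₂, hn⟩ := exists_linearCombination_sumElim (X := M) n
  have hx' : x + Finsupp.linearCombination ℤ (fun _ : Fin 1 => c) n₁ ∈ pureClosure C := by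
    refine add_mem ((AddSubgroup.closure_le _).2 (subset_pureClosure C) hx) ?_
    rw [Finsupp.linearCombination_apply]
    exact sum_mem fun i _ => zsmul_mem hc _
  have hD : ∀ t, (∀ l, s t l ∈ D) → Finsupp.linearCombination ℤ (s t) n₂ +
      (x + Finsupp.linearCombination ℤ (fun _ : Fin 1 => c) n₁) ∈ pureClosure D := fun t ht => by
    refine add_mem ?_ (pureClosure_mono hCD hx')
    rw [Finsupp.linearCombination_apply]
    exact sum_mem fun i _ => zsmul_mem (subset_pureClosure D (ht i)) _
  have key : ∀ t, Finsupp.linearCombination ℤ (Sum.elim (fun i => c + p ^ k • e i) (s t)) n + x =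
      Finsupp.linearCombination ℤ e (p ^ k • n₁) + (Finsupp.linearCombination ℤ (s t) n₂ +
        (x + Finsupp.linearCombination ℤ (fun _ : Fin 1 => c) n₁)) := fun t => by
    rw [hn, linearCombination_add_nsmul]
    abel
  -- The coefficients of `e` are the same for `s 0` and `s 1`; the parts in `⟨D⟩_P` are equally
  -- divisible since `s 0` and `s 1` have the same type over `C`.
  rw [key, key, he.mem_powSubgroup_iff hM (fun _ => mem_pureClosure_of_nsmul) _ _ _ (hD 0 h0),
    he.mem_powSubgroup_iff hM (fun _ => mem_pureClosure_of_nsmul) _ _ _ (hD 1 h1),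
    (hs.sameType 0 1).mem_powSubgroup_iff hM n₂ hx' r]

/-- The type of an element of the closure of `⟨C⟩_P` does not split strongly over `C`. -/
theorem not_splitsStrongly_of_forall_near (hM : IsPComplete p M) {C D : Set M} {a : M}
    (ha : ∀ k, ∃ c ∈ pureClosure C, a - c ∈ powSubgroup p k) :
    ¬ SplitsStrongly p (fun _ : Fin 1 => a) D C := by
  rintro ⟨m, s, hs, -, -, H⟩
  refine H ((sameType_iff hM).2 fun n x hx r => ?_)
  obtain ⟨n₁, n₂, hn⟩ := exists_linearCombination_sumElim (X := M) n
  -- To test divisibility by `p ^ r`, `a` may be replaced by an element of `⟨C⟩_P` congruent to it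
  -- modulo `p ^ r`.
  obtain ⟨c, hc, hac⟩ := ha r
  have hx' : x + n₁ 0 • c ∈ pureClosure C :=
    add_mem ((AddSubgroup.closure_le _).2 (subset_pureClosure C) hx) (zsmul_mem hc _)
  have key : ∀ t, Finsupp.linearCombination ℤ (Sum.elim (fun _ => a) (s t)) n + x ∈
      powSubgroup p r ↔ Finsupp.linearCombination ℤ (s t) n₂ + (x + n₁ 0 • c) ∈
        powSubgroup p r := fun t => by
    have h : Finsupp.linearCombination ℤ (Sum.elim (fun _ => a) (s t)) n + x =
        n₁ 0 • (a - c) + (Finsupp.linearCombination ℤ (s t) n₂ + (x + n₁ 0 • c)) := by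
      rw [hn, smul_sub, Finsupp.linearCombination_apply ℤ n₁, Finsupp.sum_fintype _ _ (by simp)]
      simp only [Finset.univ_unique, Fin.default_eq_zero, Finset.sum_singleton]
      abel
    rw [h, AddSubgroup.add_mem_cancel_left _ (zsmul_mem hac _)]
  rw [key, key, (hs.sameType 0 1).mem_powSubgroup_iff hM n₂ hx' r]

end SameType

/-! ### Pure closures of small sets are small. -/

section Cardinality

variable {M : Type u} [AddCommGroup M] {lam : Cardinal.{u}}

theorem mk_closure_lt (hlam : ℵ₀ < lam) {D : Set M} (hD : #D < lam) :
    #(AddSubgroup.closure D) < lam := by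
  let F : List (D × ℤ) → AddSubgroup.closure D := fun l =>
    (l.map fun q => q.2 • (⟨q.1, AddSubgroup.subset_closure q.1.2⟩ :
      AddSubgroup.closure D)).sum
  have hF : Function.Surjective F := by
    rintro ⟨x, hx⟩
    induction hx using AddSubgroup.closure_induction with
    | mem x hx => exact ⟨[(⟨x, hx⟩, 1)], Subtype.ext (by simp [F])⟩
    | zero => exact ⟨[], Subtype.ext (by simp [F])⟩
    | add x y hx hy ihx ihy =>
      obtain ⟨l, hl⟩ := ihx
      obtain ⟨l', hl'⟩ := ihy
      refine ⟨l ++ l', ?_⟩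
      simp only [F, List.map_append, List.sum_append] at hl hl' ⊢
      rw [hl, hl']
      rfl
    | neg x hx ih =>
      obtain ⟨l, hl⟩ := ih
      refine ⟨l.map fun q => (q.1, -q.2), ?_⟩
      have : F (l.map fun q => (q.1, -q.2)) = -F l := by
        clear hl
        induction l with
        | nil => simp [F]
        | cons q l ih =>
          simp only [F, List.map_cons, List.sum_cons, neg_smul, neg_add] at ih ⊢
          rw [ih]
      rw [this, hl]
      rfl
  refine ((mk_le_of_surjective hF).trans (mk_list_le_max _)).trans_lt (max_lt hlam ?_)
  rw [mk_prod, lift_id'.{0, u}, mk_int, lift_aleph0]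
  exact mul_lt_of_lt hlam.le hD hlam

theorem mk_pureClosure_lt {p : ℕ} [Fact p.Prime] (hM : IsPComplete p M) (hlam : ℵ₀ < lam)
    {D : Set M} (hD : #D < lam) : #(pureClosure D) < lam := by
  choose n hn hx using fun x : pureClosure D => mem_pureClosure.1 x.2
  have inj : Function.Injective fun x : pureClosure D =>
      ((⟨n x • x.1, hx x⟩, n x) : AddSubgroup.closure D × ℕ) := fun x y h => by
    simp only [Prod.mk.injEq, Subtype.mk.injEq] at h
    obtain ⟨h1, h2⟩ := h
    rw [← h2, ← sub_eq_zero, ← smul_sub, ← natCast_zsmul] at h1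
    exact Subtype.ext (sub_eq_zero.1 (hM.eq_zero_of_zsmul (by exact_mod_cast (hn x).ne') h1))
  refine (mk_le_of_injective inj).trans_lt ?_
  rw [mk_prod, lift_id'.{0, u}, mk_nat, lift_aleph0]
  exact mul_lt_of_lt hlam.le (mk_closure_lt hlam hD) hlam

end Cardinality

/-! ### Independent sequences in the monster model, and the bound `ℵ₀ < κ`. -/

section Monster

variable {p : ℕ} {M : Type u} [AddCommGroup M] {lam : Cardinal.{u}}
  {ι : Type u} {e : ι → M}

/-- Modulo `p`, the elements of `G` involve fewer than `lam` basis vectors in all, so infinitely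
many basis vectors remain untouched. -/
theorem IsTopBasis.exists_indepOver (he : IsTopBasis p e) (hlam : ℵ₀ < lam) (hι : lam ≤ #ι)
    {G : AddSubgroup M} (hG : #G < lam) : ∃ f : ℕ → M, IndepOver p G f := by
  choose n hn using he.exists_sub_mem
  let T : Set ι := ⋃ x : G, ((n x).support : Set ι)
  have hT : #T < lam := by
    refine (mk_iUnion_le _).trans_lt (mul_lt_of_lt hlam.le hG (lt_of_le_of_lt ?_ hlam))
    exact ciSup_le' fun x => (Finset.countable_toSet _).le_aleph0
  have hTc : Infinite (Tᶜ : Set ι) := by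
    rw [infinite_iff]
    by_contra! h
    have := mk_sum_compl T
    exact absurd (hι.trans this.ge) (not_le.2 (add_lt_of_lt hlam.le hT (h.trans hlam)))
  obtain ⟨h⟩ : Nonempty (ℕ ↪ (Tᶜ : Set ι)) := ⟨Infinite.natEmbedding _⟩
  let h' : ℕ ↪ ι := h.trans (Function.Embedding.subtype _)
  refine ⟨fun k => e (h' k), fun m x hx hm k => ?_⟩
  have hk : (n x) (h' k) = 0 := by
    by_contra hne
    exact (h k).2 (Set.mem_iUnion.2 ⟨⟨x, hx⟩, Finset.mem_coe.2 (Finsupp.mem_support_iff.2 hne)⟩)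
  have := he.indep (m.embDomain h' + n x) 0 (zero_mem _) (by
    have := sub_mem hm (hn x)
    rw [map_add, add_zero, Finsupp.linearCombination_embDomain]
    rwa [add_sub_assoc, sub_sub_cancel] at this) (h' k)
  rwa [Finsupp.add_apply, hk, add_zero, Finsupp.embDomain_apply_self] at this

theorem IndepOver.over_closure_image {g : ℕ → M} (hg : IndepOver p ⊥ g) {S : Set ℕ} {h : ℕ → ℕ}
    (hh : Function.Injective h) (hS : ∀ k, h k ∉ S) :
    IndepOver p (AddSubgroup.closure (g '' S)) (g ∘ h) := by
  intro n x hx hn k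
  rw [← Submodule.span_int_eq_addSubgroupClosure, Submodule.mem_toAddSubgroup,
    Finsupp.mem_span_image_iff_linearCombination] at hx
  obtain ⟨m, hm, rfl⟩ := hx
  have := hg (n.embDomain ⟨h, hh⟩ + m) 0 (zero_mem _) (by
    rwa [add_zero, map_add, Finsupp.linearCombination_embDomain]) (h k)
  rwa [Finsupp.add_apply, (Finsupp.mem_supported' _ _).1 hm _ (hS k), add_zero,
    show h k = (⟨h, hh⟩ : ℕ ↪ ℕ) k from rfl, Finsupp.embDomain_apply_self] at this

variable [Fact p.Prime]

/-- The later terms are chosen independent over the subgroup generated by `G` and `e₀`. Their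
coefficients are then divisible by `p` first, which leaves a condition on `e₀` alone. -/
theorem IsTopBasis.exists_indepOver_start (he : IsTopBasis p e) (hlam : ℵ₀ < lam)
    (hι : lam ≤ #ι) {G : AddSubgroup M} (hG : #G < lam) {e₀ : M}
    (he₀ : ∀ x ∈ G, e₀ + x ∉ powSubgroup p 1) : ∃ f : ℕ → M, f 0 = e₀ ∧ IndepOver p G f := by
  have hGe : #((G : Set M) ∪ {e₀} : Set M) < lam :=
    (mk_union_le _ _).trans_lt (add_lt_of_lt hlam.le hG (by
      rw [mk_singleton]; exact one_lt_aleph0.trans hlam))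
  obtain ⟨g, hg⟩ := he.exists_indepOver hlam hι (mk_closure_lt hlam hGe)
  have hGle : G ≤ AddSubgroup.closure ((G : Set M) ∪ {e₀}) := fun x hx =>
    AddSubgroup.subset_closure (Or.inl hx)
  let f : ℕ → M := fun k => if k = 0 then e₀ else g k
  refine ⟨f, if_pos rfl, fun n x hx h j => ?_⟩
  have h1 : Finsupp.linearCombination ℤ f (n.erase 0) =
      Finsupp.linearCombination ℤ g (n.erase 0) := by
    rw [Finsupp.linearCombination_apply, Finsupp.linearCombination_apply]
    refine Finsupp.sum_congr fun k hk => ?_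
    have : k ≠ 0 := by rintro rfl; simp at hk
    simp [f, this]
  have h2 : Finsupp.linearCombination ℤ f n + x =
      Finsupp.linearCombination ℤ g (n.erase 0) + (n 0 • e₀ + x) := by
    conv_lhs => rw [← Finsupp.erase_add_single 0 n]
    rw [map_add, h1, Finsupp.linearCombination_single, add_assoc]
    rfl
  rw [h2] at h
  have he₀' : e₀ ∈ AddSubgroup.closure ((G : Set M) ∪ {e₀}) :=
    AddSubgroup.subset_closure (Or.inr rfl)
  have h3 := hg (n.erase 0) _ (add_mem (zsmul_mem he₀' _) (hGle hx)) h
  rcases eq_or_ne j 0 with rfl | hj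
  · have h4 : Finsupp.linearCombination ℤ g (n.erase 0) ∈ powSubgroup p 1 := by
      rw [Finsupp.linearCombination_apply]
      exact sum_mem fun k _ => zsmul_mem_powSubgroup_of_dvd (by simpa using h3 k) _
    have h5 : n 0 • e₀ + x ∈ powSubgroup p 1 := by simpa using sub_mem h h4
    have h6 := indepOver_of_forall_notMem (e := fun _ : Fin 1 => e₀) he₀
      (Finsupp.single 0 (n 0)) x hx (by simpa using h5) 0
    simpa using h6
  · simpa [Finsupp.erase_ne hj] using h3 j

/-- This makes the infimum defining `kappa` attained. Each strong splitting puts a new element into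
the next set, so no splitting sequence is longer than `M` allows. -/
theorem exists_not_hasStronglySplittingSequence (hM : IsPComplete p M) (lam : Cardinal.{u}) :
    ∃ μ, ¬ HasStronglySplittingSequence p M lam μ := by
  refine ⟨Order.succ (max ℵ₀ #M), ?_⟩
  set μ := Order.succ (max ℵ₀ #M) with hμ
  rintro ⟨n, a, A, -, h⟩
  have hlim : Order.IsSuccLimit μ.ord :=
    isSuccLimit_ord ((le_max_left _ _).trans (Order.le_succ _))
  have hex : ∀ i : Set.Iio μ.ord, ∃ x ∈ A (Order.succ i.1), x ∉ A i.1 := fun ⟨i, hi⟩ => by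
    obtain ⟨-, m, s, hs, h0, -, H⟩ := h i (Order.succ i) (Order.lt_succ i) (hlim.succ_lt hi)
    by_contra! hA
    -- If `s 0` already lay in `A i`, the embeddings witnessing that `s 0` and `s 1` have the same
    -- type over `A i` would force `s 0 = s 1`, excluding splitting.
    obtain ⟨N, _, -, f, g, -, hg, hfg, hst⟩ := hs.sameType 0 1
    have : s 0 = s 1 := funext fun l => hg.1 ((hfg _ (hA _ (h0 l))).symm.trans (hst l))
    rw [this] at H
    exact H (SameType.refl hM _ _)
  choose x hx hx' using hex
  have hlt : ∀ i j : Set.Iio μ.ord, i < j → x i ≠ x j := fun i j hij hxij => by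
    refine hx' j (hxij ▸ ?_)
    rcases (Order.succ_le_of_lt (show i.1 < j.1 from hij)).eq_or_lt with heq | hlt
    · rw [← heq]; exact hx i
    · exact (h _ _ hlt j.2).1 (hx i)
  have inj : Function.Injective x := fun i j hij => by
    rcases lt_trichotomy i j with hlt' | rfl | hlt'
    · exact absurd hij (hlt _ _ hlt')
    · rfl
    · exact absurd hij.symm (hlt _ _ hlt')
  have := lift_mk_le_lift_mk_of_injective inj
  rw [mk_Iio_ordinal, card_ord, lift_lift, lift_le] at this
  exact absurd this (not_le.2 ((le_max_right _ _).trans_lt (Order.lt_succ _)))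

theorem mem_closure_image_of_nsmul (hM : IsPComplete p M) {g : ℕ → M} (hg : IndepOver p ⊥ g)
    (S : Set ℕ) {x : M} (hx : p • x ∈ AddSubgroup.closure (g '' S)) :
    x ∈ AddSubgroup.closure (g '' S) := by
  have hspan : ∀ y, y ∈ AddSubgroup.closure (g '' S) ↔
      ∃ n ∈ Finsupp.supported ℤ ℤ S, Finsupp.linearCombination ℤ g n = y := fun y => by
    rw [← Submodule.span_int_eq_addSubgroupClosure, Submodule.mem_toAddSubgroup,
      Finsupp.mem_span_image_iff_linearCombination]
  obtain ⟨n, hn, hnx⟩ := (hspan _).1 hx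
  have hdvd := hg n 0 (zero_mem _) (by
    rw [hnx, add_zero]; simpa using nsmul_mem_powSubgroup (p := p) 1 x)
  obtain ⟨n', rfl⟩ := exists_eq_zsmul_finsupp hdvd
  have hp0 : (p : ℤ) ≠ 0 := by exact_mod_cast (Fact.out : p.Prime).ne_zero
  refine (hspan x).2 ⟨n', (Finsupp.mem_supported' _ _).2 fun k hk => ?_, ?_⟩
  · have := (Finsupp.mem_supported' _ _).1 hn k hk
    exact (mul_eq_zero.1 this).resolve_left hp0
  · rw [map_smul, natCast_zsmul, ← sub_eq_zero, ← smul_sub] at hnx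
    exact sub_eq_zero.1 (hM.torsionFree _ hnx)

/-- The witness is `a = ∑ p ^ k • g (2 * k)`. Stage `o` is generated by the `g l` with `l / 2 < o`.
Over stage `i`, the splitting sequence is `c i + p ^ i • g (2 * i + l)`: `a` agrees with its first
term modulo `p ^ (i + 1)`, and `g (2 * i + 1)` supplies the second. -/
theorem hasStronglySplittingSequence_of_le_aleph0 (hM : IsPComplete p M) (hlam : ℵ₀ < lam)
    {g : ℕ → M} (hg : IndepOver p ⊥ g) {μ : Cardinal.{u}} (hμ : μ ≤ ℵ₀) :
    HasStronglySplittingSequence p M lam μ := by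
  let c : ℕ → M := fun i => ∑ k ∈ Finset.range i, p ^ k • g (2 * k)
  obtain ⟨a, ha⟩ := hM.complete c fun k => by
    simp [c, Finset.sum_range_succ, nsmul_mem_powSubgroup]
  let S : Ordinal.{u} → Set ℕ := fun o => {l | ((l / 2 : ℕ) : Ordinal.{u}) < o}
  have hS : ∀ (l : ℕ) (o : Ordinal.{u}), ((l / 2 : ℕ) : Ordinal.{u}) < o → l ∈ S o :=
    fun _ _ h => h
  refine ⟨1, fun _ => a, fun o => AddSubgroup.closure (g '' S o), fun i _ => ?_,
    fun i j hij hj => ?_⟩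
  · exact mk_closure_lt hlam (((Set.to_countable (S i)).image g).le_aleph0.trans_lt hlam)
  have hi : i < Ordinal.omega0 := by
    rw [← ord_aleph0]
    exact (hij.trans hj).trans_le (ord_le_ord.2 hμ)
  obtain ⟨i, rfl⟩ := Ordinal.lt_omega0.1 hi
  have hle : AddSubgroup.closure (g '' S i) ≤ AddSubgroup.closure (g '' S j) :=
    AddSubgroup.closure_mono (Set.image_mono fun l hl => lt_trans hl hij)
  have hmem : ∀ l, l / 2 = i → g l ∈ AddSubgroup.closure (g '' S j) := fun l hl =>
    AddSubgroup.subset_closure ⟨l, hS l j (hl ▸ hij), rfl⟩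
  have hc : c i ∈ AddSubgroup.closure (g '' S i) := sum_mem fun k hk =>
    nsmul_mem (AddSubgroup.subset_closure (Set.mem_image_of_mem g (hS _ _ (by simpa using hk)))) _
  refine ⟨hle, splitsStrongly_of_indepOver hM (fun x => mem_closure_image_of_nsmul hM hg (S i))
    le_rfl (hg.over_closure_image (h := fun l => 2 * i + l) (add_right_injective _) fun k => ?_)
    hc i _ ?_ ?_ ?_⟩
  · rw [show (2 * i + k ∈ S i) ↔ _ from Iff.rfl, Set.mem_ofPred_eq, Nat.cast_lt]
    omega
  · have := ha (i + 1)
    simpa [c, Finset.sum_range_succ] using this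
  · exact add_mem (hle hc) (nsmul_mem (hmem _ (by simp)) _)
  · exact add_mem (hle hc) (nsmul_mem (hmem _ (by simp; omega)) _)

theorem aleph0_lt_kappa (hM : IsPComplete p M) (hlam : ℵ₀ < lam)
    {g : ℕ → M} (hg : IndepOver p ⊥ g) : ℵ₀ < kappa p M lam := by
  by_contra! h
  exact csInf_mem (exists_not_hasStronglySplittingSequence hM lam)
    (hasStronglySplittingSequence_of_le_aleph0 hM hlam hg h)

end Monster

/-! ### Distances as approximability modulo powers of `p`. -/

section Distance

variable {p : ℕ} {M : Type u} [AddCommGroup M]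

theorem pNorm_nonneg (x : M) : 0 ≤ pNorm p x :=
  Real.sInf_nonneg (by rintro _ ⟨k, -, rfl⟩; positivity)

theorem pNorm_le_of_mem {x : M} {k : ℕ} (hx : x ∈ powSubgroup p k) :
    pNorm p x ≤ ((p : ℝ) ^ k)⁻¹ := by
  obtain ⟨y, rfl⟩ := mem_powSubgroup.1 hx
  exact csInf_le ⟨0, by rintro _ ⟨k, -, rfl⟩; positivity⟩ ⟨k, ⟨y, rfl⟩, rfl⟩

theorem le_pNorm {x : M} {r : ℝ} (h : ∀ k, x ∈ powSubgroup p k → r ≤ ((p : ℝ) ^ k)⁻¹) :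
    r ≤ pNorm p x := by
  refine le_csInf ⟨_, 0, ⟨x, by simp⟩, rfl⟩ ?_
  rintro _ ⟨k, ⟨y, rfl⟩, rfl⟩
  exact h k (nsmul_mem_powSubgroup k y)

theorem exists_mem_of_pNorm_lt {x : M} {r : ℝ} (h : pNorm p x < r) :
    ∃ k, x ∈ powSubgroup p k ∧ ((p : ℝ) ^ k)⁻¹ < r := by
  by_contra! H
  exact absurd h (not_lt.2 (le_pNorm H))

variable [hp : Fact p.Prime]

theorem distTo_le_iff {a : M} {S : Set M} (hS : S.Nonempty) {k : ℕ} :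
    distTo p a S ≤ ((p : ℝ) ^ k)⁻¹ ↔ ∃ b ∈ S, a - b ∈ powSubgroup p k := by
  have hp1 : (1 : ℝ) < p := by exact_mod_cast hp.out.one_lt
  constructor
  · intro h
    -- The infimum is turned into an actual element at the cost of a factor `p`; since only powers
    -- of `p` occur, the strict inequality recovers the exponent `k`.
    have hlt : distTo p a S < ((p : ℝ) ^ k)⁻¹ * p :=
      h.trans_lt (lt_mul_of_one_lt_right (by positivity) hp1)
    obtain ⟨_, ⟨b, hb, rfl⟩, hbr⟩ := exists_lt_of_csInf_lt (hS.image _) hlt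
    obtain ⟨j, hj, hjr⟩ := exists_mem_of_pNorm_lt hbr
    refine ⟨b, hb, powSubgroup_anti ?_ hj⟩
    rw [inv_mul_eq_div, lt_div_iff₀ (by positivity), inv_mul_lt_iff₀ (by positivity),
      ← pow_succ] at hjr
    exact Nat.lt_succ_iff.1 ((pow_lt_pow_iff_right₀ hp1).1 hjr)
  · rintro ⟨b, hb, hab⟩
    have hbdd : BddBelow ((fun b => pNorm p (a - b)) '' S) :=
      ⟨0, by rintro _ ⟨b, -, rfl⟩; exact pNorm_nonneg _⟩
    exact (csInf_le hbdd (Set.mem_image_of_mem _ hb)).trans (pNorm_le_of_mem hab)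

theorem distTo_eq_iff {a : M} {S T : Set M} (hS : S.Nonempty) (hT : T.Nonempty) :
    distTo p a S = distTo p a T ↔
      ∀ k, (∃ b ∈ S, a - b ∈ powSubgroup p k) ↔ ∃ b ∈ T, a - b ∈ powSubgroup p k := by
  refine ⟨fun h k => by rw [← distTo_le_iff hS, ← distTo_le_iff hT, h], fun h => ?_⟩
  have key : ∀ {S T : Set M}, S.Nonempty → T.Nonempty →
      (∀ k, (∃ b ∈ T, a - b ∈ powSubgroup p k) → ∃ b ∈ S, a - b ∈ powSubgroup p k) →
      distTo p a S ≤ distTo p a T := fun hS hT h => by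
    refine le_csInf (hT.image _) ?_
    rintro _ ⟨b, hb, rfl⟩
    exact le_pNorm fun k hk => (distTo_le_iff hS).2 (h k ⟨b, hb, hk⟩)
  exact le_antisymm (key hS hT fun k => (h k).2) (key hT hS fun k => (h k).1)

end Distance

/-! ### The two implications. -/

section Main

variable {p : ℕ} {M : Type u} [AddCommGroup M] {lam : Cardinal.{u}}
  {ι : Type u} {e : ι → M}

/-- If the distance `p ^ (-m)` from `x` to a pure subgroup `G` is positive, then
`x = c + p ^ m e` with `c ∈ G` and `e` outside `p M + G`. -/
theorem exists_eq_add_nsmul {G : AddSubgroup M} {x : M} {k : ℕ}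
    (hk : ∀ b ∈ G, x - b ∉ powSubgroup p k) :
    ∃ m < k, ∃ c ∈ G, ∃ y : M, x = c + p ^ m • y ∧ ∀ g ∈ G, y + g ∉ powSubgroup p 1 := by
  classical
  have hex : ∃ k, ∀ b ∈ G, x - b ∉ powSubgroup p k := ⟨k, hk⟩
  have hspec := Nat.find_spec hex
  have hpos : Nat.find hex ≠ 0 := fun h0 => by
    rw [h0] at hspec
    exact hspec 0 (zero_mem _) (mem_powSubgroup_zero _)
  obtain ⟨m, hm⟩ := Nat.exists_eq_succ_of_ne_zero hpos
  have hmin := Nat.find_min hex (m := m) (by omega)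
  push Not at hmin
  obtain ⟨c, hc, hxc⟩ := hmin
  obtain ⟨y, hy⟩ := mem_powSubgroup.1 hxc
  refine ⟨m, ?_, c, hc, y, by rw [hy, add_sub_cancel], fun g hg h => ?_⟩
  · have := Nat.find_min' hex hk
    omega
  · rw [hm] at hspec
    refine hspec (c - p ^ m • g) (sub_mem hc (nsmul_mem hg _)) ?_
    have := nsmul_mem_powSubgroup_add (j := m) h
    rwa [smul_add, hy, sub_add] at this

variable [Fact p.Prime]

theorem mem_pureClosure_of_pow_nsmul {A : Set M} (k : ℕ) {x : M}
    (hx : p ^ k • x ∈ pureClosure A) : x ∈ pureClosure A := by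
  obtain ⟨n, hn, h⟩ := hx
  exact ⟨n * p ^ k, Nat.mul_pos hn (pow_pos (Fact.out : p.Prime).pos k), by rwa [mul_smul]⟩

theorem indep_of_forall_near (hM : IsPComplete p M) (he : IsTopBasis p e) (hlam : ℵ₀ < lam)
    (hι : lam ≤ #ι) {A B : Set M} {a : M}
    (h : ∀ k, (∃ b ∈ pureClosure (A ∪ B), a - b ∈ powSubgroup p k) →
      ∃ b ∈ pureClosure A, a - b ∈ powSubgroup p k) :
    Indep p lam (fun _ : Fin 1 => a) A B := by
  obtain ⟨g, hg⟩ := he.exists_indepOver (G := (⊥ : AddSubgroup M)) hlam hι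
    (by rw [mk_fintype, Fintype.card_unique, Nat.cast_one]; exact one_lt_aleph0.trans hlam)
  have hκ : ℵ₀ < kappa p M lam := aleph0_lt_kappa hM hlam hg
  -- The cases are distance zero, where `C` collects countably many finite supports, and positive
  -- distance, where one finite support suffices.
  by_cases hnear : ∀ k, ∃ c ∈ pureClosure A, a - c ∈ powSubgroup p k
  · choose c hc hac using hnear
    choose F hFA hF hcF using fun k => exists_finite_of_mem_pureClosure (hc k)
    refine ⟨⋃ k, F k, Set.iUnion_subset hFA,
      ((Set.countable_iUnion fun k => (hF k).countable).le_aleph0).trans_lt hκ,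
      fun D _ _ => ⟨_, SameType.refl hM _ _, not_splitsStrongly_of_forall_near hM fun k =>
        ⟨c k, pureClosure_mono (Set.subset_iUnion F k) (hcF k), hac k⟩⟩⟩
  · push Not at hnear
    obtain ⟨k, hk⟩ := hnear
    obtain ⟨m, -, c, hc, y, hay, hy⟩ := exists_eq_add_nsmul hk
    obtain ⟨F, hFA, hF, hcF⟩ := exists_finite_of_mem_pureClosure hc
    refine ⟨F, hFA, hF.countable.le_aleph0.trans_lt hκ, fun D hD hDlam => ?_⟩
    obtain ⟨f, hf⟩ := he.exists_indepOver hlam hι (mk_pureClosure_lt hM hlam hDlam)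
    have hf' : IndepOver p (pureClosure D) fun _ : Fin 1 => f 0 :=
      hf.comp (h := fun _ : Fin 1 => 0) (Function.injective_of_subsingleton _)
    refine ⟨fun _ => c + p ^ m • f 0, ?_, not_splitsStrongly_of_indepOver hM
      (hFA.trans (Set.subset_union_left.trans hD)) hf' hcF m⟩
    have hAB : pureClosure A ≤ pureClosure (A ∪ B) := pureClosure_mono Set.subset_union_left
    -- Here the distance hypothesis enters: if `y` were congruent modulo `p` to an element of `⟨A ∪
    -- B⟩_P`, then `a` would be approximable modulo `p ^ (m + 1)` from `⟨A⟩_P`. Comparing with `c`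
    -- and dividing by `p ^ m` inside the pure subgroup contradicts the choice of `y`.
    have hy' : ∀ g ∈ pureClosure (A ∪ B), y + g ∉ powSubgroup p 1 := fun g hg hyg => by
      have h1 := nsmul_mem_powSubgroup_add (j := m) hyg
      obtain ⟨b, hb, hab⟩ := h (m + 1) ⟨c - p ^ m • g, sub_mem (hAB hc) (nsmul_mem hg _), by
        rwa [hay, add_sub_sub_cancel, ← smul_add]⟩
      have h2 : p ^ m • y + (c - b) ∈ powSubgroup p (m + 1) := by
        rwa [hay, add_comm c, add_sub_assoc] at hab
      obtain ⟨d, hd⟩ := mem_powSubgroup.1 (show c - b ∈ powSubgroup p m by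
        have := sub_mem (powSubgroup_anti (Nat.le_succ m) h2) (nsmul_mem_powSubgroup m y)
        rwa [add_sub_cancel_left] at this)
      rw [← hd, ← smul_add, hM.pow_nsmul_mem_iff] at h2
      exact hy d (mem_pureClosure_of_pow_nsmul m (hd ▸ sub_mem hc hb)) h2
    rw [hay]
    exact sameType_of_indepOver hM (fun _ => mem_pureClosure_of_nsmul) (subset_pureClosure _)
      (fun n x hx => hf' n x (pureClosure_mono hD hx))
      (indepOver_of_forall_notMem hy') (fun _ => hAB hc) m

theorem near_of_indep (hM : IsPComplete p M) (he : IsTopBasis p e) (hlam : ℵ₀ < lam)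
    (hι : lam ≤ #ι) {A B : Set M} (hA : #A < lam) (hB : #B < lam) {a : M}
    (h : Indep p lam (fun _ : Fin 1 => a) A B) {k : ℕ}
    (hk : ∃ b ∈ pureClosure (A ∪ B), a - b ∈ powSubgroup p k) :
    ∃ b ∈ pureClosure A, a - b ∈ powSubgroup p k := by
  by_contra! hA'
  obtain ⟨c, hc, hac⟩ := hk
  obtain ⟨C, hCA, -, hC⟩ := h
  have hClam : #C < lam := (mk_le_mk_of_subset hCA).trans_lt hA
  have hcC : ∀ b ∈ pureClosure C, c - b ∉ powSubgroup p k := fun b hb hcb =>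
    hA' b (pureClosure_mono hCA hb) (by simpa using add_mem hac hcb)
  -- The decomposition is of `c`, not of `a`, so that the first term of the splitting sequence is
  -- `c` itself.
  obtain ⟨m, hmk, c₀, hc₀, y, rfl, hy⟩ := exists_eq_add_nsmul hcC
  obtain ⟨f, rfl, hf⟩ := he.exists_indepOver_start hlam hι (mk_pureClosure_lt hM hlam hClam) hy
  have hD : #(A ∪ B ∪ {c₀ + p ^ m • f 0, c₀ + p ^ m • f 1} : Set M) < lam :=
    (mk_union_le _ _).trans_lt (add_lt_of_lt hlam.le
      ((mk_union_le _ _).trans_lt (add_lt_of_lt hlam.le hA hB))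
      ((Set.toFinite _).countable.le_aleph0.trans_lt hlam))
  obtain ⟨b, hb, hbs⟩ := hC _ Set.subset_union_left hD
  refine hbs (splitsStrongly_of_indepOver hM (fun _ => mem_pureClosure_of_nsmul)
    (subset_pureClosure C) hf hc₀ m b ?_ (by simp) (by simp))
  -- The type over `A ∪ B` transfers the congruence of `a` with `c` modulo `p ^ k` to `b`; as `m + 1
  -- ≤ k`, this is precise enough to split.
  refine powSubgroup_anti hmk ?_
  have := hb.mem_powSubgroup_iff hM (Finsupp.single 0 1) (neg_mem hc) k
  simp only [Finsupp.linearCombination_single, one_smul, ← sub_eq_add_neg] at this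
  exact this.2 hac

end Main

end PadicClass

theorem proposition66 (p : ℕ) [Fact p.Prime]
    (M : Type u) [AddCommGroup M] (ι : Type u)
    (hM : Nonempty (M ≃+ PadicClass.FreeCompletion p ι))
    (lam : Cardinal.{u}) (hlam : Cardinal.aleph0 < lam) (hι : lam ≤ Cardinal.mk ι)
    (A B : Set M) (hA : Cardinal.mk A < lam) (hB : Cardinal.mk B < lam) (a : M) :
    PadicClass.Indep p lam (fun _ : Fin 1 => a) A B ↔
      PadicClass.distTo p a (PadicClass.pcl A) =
        PadicClass.distTo p a (PadicClass.pcl (A ∪ B)) := by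
  obtain ⟨φ⟩ := hM
  have hc := (PadicClass.isPComplete_freeCompletion p ι).of_addEquiv φ.symm
  have he := (PadicClass.isTopBasis_freeCompletion p ι).of_addEquiv φ.symm
  have hle := PadicClass.pureClosure_mono (A := A) (B := A ∪ B) Set.subset_union_left
  refine Iff.trans ?_ (PadicClass.distTo_eq_iff ⟨0, zero_mem (PadicClass.pureClosure A)⟩
    ⟨0, zero_mem (PadicClass.pureClosure (A ∪ B))⟩).symm
  exact ⟨fun h k => ⟨fun ⟨b, hb, hab⟩ => ⟨b, hle hb, hab⟩,
    PadicClass.near_of_indep hc he hlam hι hA hB h⟩,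
    fun h => PadicClass.indep_of_forall_near hc he hlam hι fun k => (h k).2⟩
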